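/- **Setting.** Let $d_X\ge 1$, let $(X_i,W_i)$, $i\ge1$, be i.i.d. with law $P$, where $X_i\in\mathbb{R}^{d_X}$ and $W_i$ takes values in a measurable space $\mathcal W$ (such as $\mathbb{R}^{d_W}$ or a Borel subset of it). Let $\Theta\subseteq\mathbb{R}^d$, let $m:\mathcal W\times\Theta\to\mathbb{R}^{d_Y}$ be measurable in its first argument, let $\bar m(\theta,x)$ be a version of $E_P[m(W_i,\theta)\mid X_i=x]$, and let $$\Theta_0(P)=\{\theta\in\Theta:\ E_P[m(W_i,\theta)\mid X_i]\ge 0\ \text{a.s.}\}.$$ Write $\operatorname{supp}_P(X_i)$ for the support of $X_i$, $\|\cdot\|$ for the Euclidean norm, $E_n$ for the sample mean over $i\le n$, and $d_H$ for the Hausdorff distance, $d_H(A,B)=\max\{\sup_{a\in A}\inf_{b\in B}\|a-b\|,\sup_{b\in B}\inf_{a\in A}\|a-b\|\}\in[0,\infty]$. For a kernel $k:\mathbb{R}^{d_X}\to\mathbb{R}$ and bandwidths $h_n>0$, $h_n\to0$, put $$\hat{\bar m}_j(\theta,x)=\frac{E_n m_j(W_i,\theta)k((X_i-x)/h_n)}{E_n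 k((X_i-x)/h_n)}\quad(0/0:=0),\qquad T_n(\theta)=\sup_{x\in\operatorname{supp}_P(X_i)}S(\hat{\bar m}(\theta,x)),$$ $$\mathcal C_n(\hat c_n)=\Big\{\theta\in\Theta:\ \tfrac{\sqrt{n h_n^{d_X}}}{\sqrt{\log n}}\,T_n(\theta)\le\hat c_n\Big\},$$ where the critical values $\hat c_n$ may be random. **Assumptions.** 1. $S:\mathbb{R}^{d_Y}\to[0,\infty)$; $S(t)>0$ iff $t_j<0$ for some $j$; and for some $K_1,K_2>0$ and all $c>0$: $S(t)\ge c$ implies $t_j\le -cK_1$ for some $j$, and $S(t)\le c$ implies $t_j\ge -cK_2$ for all $j$. 2. $k$ is measurable, nonnegative, bounded, square integrable, integrates to one, and is bounded away from zero on some neighborhood of $0$. Let $\mathcal G=\{t\mapsto k((t-x)/h): x\in\mathbb{R}^{d_X},h>0\}$. For some $\overline Y\ge0$ and all $\theta\in\Theta$, $g\in\mathcal G$, $j$: $|m_j(W_i,\theta)g(X_i)|\le\overline Y$ a.s. Moreover, for some $A,V>0$ and all $j$, the classes $\mathcal F_{j,1}=\{s\,m_j(w,\theta)g(x)+t:\theta\in\Theta,g\in\mathcal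 G,\ s,t\in[-(\overline Y\vee1),\overline Y\vee1]\}$ and $\mathcal F_{j,2}=\{f^2:f\in\mathcal F_{j,1}\}$ have $L_1(Q)$ covering numbers bounded by $A\varepsilon^{-V}$ for all $0<\varepsilon<1$ and all probability measures $Q$ on $\mathbb{R}^{d_X}\times\mathcal W$. 3. For some $\eta,\varepsilon_0>0$: $P(\|X_i-x\|\le\varepsilon)\ge\eta\,\varepsilon^{d_X}$ for all $0<\varepsilon\le\varepsilon_0$ and all $x\in\operatorname{supp}_P(X_i)$. 4. $X_i$ has bounded support and a bounded Lebesgue density. Let $\alpha>0$. For some boundary point $\theta_0\in\partial\Theta_0(P)$ and some ball $B\subseteq\Theta$ centered at $\theta_0$, with $x$ ranging over $\operatorname{supp}_P(X_i)$: * $\bar m(\theta,x)\ge0$ for all $\theta\in\Theta_0(P)\cap B$ and all $x$, and for $\theta\in\partial\Theta_0(P)\cap B$ each $\bar m_j(\theta,\cdot)$ attains its minimum over the support (both hold if $\bar m(\theta,\cdot)$ is continuous on the support for $\theta\in B$); * $\bar m(\theta,x)$ is differentiable in $\theta\in B$, with derivative bounded over $\theta\in B$ and $x$; * for some $\eta>0$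 and all $\theta\in\partial\Theta_0(P)\cap B$, every point $x_0$ of $\mathcal X_0(\theta)=\{x_0\in\operatorname{supp}_P(X_i):\min_k\bar m_k(\theta,x_0)=0\}$ satisfies $|\bar m_j(\theta,x)-\bar m_j(\theta,x_0)|\ge\eta(\|x-x_0\|^\alpha\wedge\eta)$ for all $x$ and all $j$; * the number of elements of $\mathcal X_0(\theta)$ is bounded over $\theta\in\partial\Theta_0(P)\cap B$. **Theorem.** Under these assumptions there are constants $a,c>0$, not depending on the bandwidths or on the critical values, such that the following holds. If $h_n>0$, $h_n\to0$, $h_n^{d_X}n/\log n\ge a$ for all large $n$, and $\hat c_n\ge c$ with probability approaching one, then, for some $\varepsilon>0$, $$P\left(\left(\frac{\sqrt{n h_n^{d_X}}}{\sqrt{\log n}}\wedge h_n^{-\alpha}\right)d_H\big(\mathcal C_n(\hat c_n),\Theta_0(P)\big)\ge\varepsilon\right)\xrightarrow[n\to\infty]{}1.$$ (For events that need not be measurable, "with probability approaching one" means that the outer probability of the complement tends to zero.) -/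

import Mathlib

open MeasureTheory ProbabilityTheory Filter Topology Set
open scoped ENNReal

noncomputable section

/-- `ℝᵈ` with its Euclidean norm. -/
abbrev Vec (d : ℕ) : Type := EuclideanSpace ℝ (Fin d)

namespace CondMoment

variable {dX dY d : ℕ} {𝒲 : Type*} [MeasurableSpace 𝒲]

/-! ### The model. An observation is a pair `z = (x, w)` of `ℝ^{d_X} × 𝒲` with law `P`. -/

/-- The `σ`-algebra on the observation space generated by `X`. -/
abbrev sigmaX (dX : ℕ) (𝒲 : Type*) : MeasurableSpace (Vec dX × 𝒲) :=
  MeasurableSpace.comap Prod.fst inferInstance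

/-- The law of `X` under `P`. -/
def lawX (P : Measure (Vec dX × 𝒲)) : Measure (Vec dX) := P.map Prod.fst

/-- The support of `X` under `P`. -/
def suppX (P : Measure (Vec dX × 𝒲)) : Set (Vec dX) := (lawX P).support

/-- The identified set: all `θ ∈ Θ` with `E_P[m(W, θ) | X] ≥ 0` almost surely (componentwise). -/
def identifiedSet (P : Measure (Vec dX × 𝒲)) (m : 𝒲 → Vec d → Vec dY) (Θ : Set (Vec d)) :
    Set (Vec d) :=
  {θ ∈ Θ | ∀ j, 0 ≤ᵐ[P] P[fun z : Vec dX × 𝒲 => m z.2 θ j | sigmaX dX 𝒲]}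

/-- `mbar θ x` is, for each `θ ∈ Θ`, a version of `E_P[m(W, θ) | X = x]`. -/
structure IsCondMean (P : Measure (Vec dX × 𝒲)) (m : 𝒲 → Vec d → Vec dY) (Θ : Set (Vec d))
    (mbar : Vec d → Vec dX → Vec dY) : Prop where
  measurable : ∀ θ ∈ Θ, Measurable (mbar θ)
  ae_eq : ∀ θ ∈ Θ, ∀ j, (fun z : Vec dX × 𝒲 => mbar θ z.1 j)
    =ᵐ[P] P[fun z : Vec dX × 𝒲 => m z.2 θ j | sigmaX dX 𝒲]

/-! ### The kernel set estimate -/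

/-- The sample mean `E_n f` of the first `n` observations. -/
def empMean {𝒵 : Type*} (n : ℕ) (z : ℕ → 𝒵) (f : 𝒵 → ℝ) : ℝ :=
  (∑ i ∈ Finset.range n, f (z i)) / n

/-- The translated and dilated kernel `t ↦ k((t - x) / h)`. -/
def dilate (k : Vec dX → ℝ) (x : Vec dX) (h : ℝ) (t : Vec dX) : ℝ := k (h⁻¹ • (t - x))

/-- The kernel estimate of `E_P[m(W, θ) | X = x]` with bandwidth `h`
(a component is `0` where the denominator vanishes). -/
def kernMean (m : 𝒲 → Vec d → Vec dY) (k : Vec dX → ℝ) (h : ℝ) (n : ℕ) (z : ℕ → Vec dX × 𝒲)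
    (θ : Vec d) (x : Vec dX) : Vec dY :=
  WithLp.toLp 2 fun j =>
    empMean n z (fun p => m p.2 θ j * dilate k x h p.1) / empMean n z (fun p => dilate k x h p.1)

/-- The statistic `T_n(θ) = sup_{x ∈ supp X} S(kernel estimate at (θ, x))`. The kernel estimate is
a weighted average of finitely many values of `m`, so the supremum is over a bounded set for the
functions `S` considered below. -/
def kernStat (P : Measure (Vec dX × 𝒲)) (m : 𝒲 → Vec d → Vec dY) (S : Vec dY → ℝ)
    (k : Vec dX → ℝ) (h : ℝ) (n : ℕ) (z : ℕ → Vec dX × 𝒲) (θ : Vec d) : ℝ :=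
  sSup ((fun x => S (kernMean m k h n z θ x)) '' suppX P)

/-- The factor `√(n h^{d_X}) / √(log n)`. -/
def kernScale (dX n : ℕ) (h : ℝ) : ℝ := √(n * h ^ dX) / √(Real.log n)

/-- The set estimate with critical value `c`. -/
def kernSet (P : Measure (Vec dX × 𝒲)) (m : 𝒲 → Vec d → Vec dY) (Θ : Set (Vec d))
    (S : Vec dY → ℝ) (k : Vec dX → ℝ) (h : ℝ) (n : ℕ) (z : ℕ → Vec dX × 𝒲) (c : ℝ) :
    Set (Vec d) :=
  {θ ∈ Θ | kernScale dX n h * kernStat P m S k h n z θ ≤ c}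

/-! ### Covering numbers -/

/-- The `L₁(Q)` covering number of `F`: the least number of `Q`-integrable functions (not
necessarily in `F`) such that each element of `F` is within `ε` of one of them in `L₁(Q)`;
`⊤` if there is no such finite collection. -/
def coveringNumber {𝒵 : Type*} [MeasurableSpace 𝒵] (ε : ℝ) (F : Set (𝒵 → ℝ)) (Q : Measure 𝒵) :
    ℕ∞ :=
  ⨅ (G : Finset (𝒵 → ℝ)) (_ : (∀ g ∈ G, Integrable g Q) ∧
    ∀ f ∈ F, ∃ g ∈ G, eLpNorm (f - g) 1 Q ≤ ENNReal.ofReal ε), (G.card : ℕ∞)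

/-- `sup_Q N(ε, F, L₁(Q)) ≤ A ε^{-V}` for `0 < ε < 1`, over all probability measures `Q`. -/
def PolyCovering {𝒵 : Type*} [MeasurableSpace 𝒵] (F : Set (𝒵 → ℝ)) (A V : ℝ) : Prop :=
  ∀ Q : Measure 𝒵, IsProbabilityMeasure Q → ∀ ε : ℝ, 0 < ε → ε < 1 →
    (coveringNumber ε F Q : ℝ≥0∞) ≤ ENNReal.ofReal (A * ε ^ (-V))

/-- The functions `(x, w) ↦ s m_j(w, θ) g(x) + t` with `θ ∈ Θ`, `g ∈ 𝒢` and
`s, t ∈ [-(Ybar ∨ 1), Ybar ∨ 1]`. -/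
def momentClass (m : 𝒲 → Vec d → Vec dY) (Θ : Set (Vec d)) (𝒢 : Set (Vec dX → ℝ)) (Ybar : ℝ)
    (j : Fin dY) : Set (Vec dX × 𝒲 → ℝ) :=
  {f | ∃ θ ∈ Θ, ∃ g ∈ 𝒢, ∃ s ∈ Icc (-(max Ybar 1)) (max Ybar 1),
    ∃ t ∈ Icc (-(max Ybar 1)) (max Ybar 1), f = fun z => s * (m z.2 θ j * g z.1) + t}

/-- The complexity condition on a class `𝒢` of weight functions: polynomial uniform covering
numbers for the classes `momentClass` and for the classes of squares of their elements. -/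
def CoveringCondition (m : 𝒲 → Vec d → Vec dY) (Θ : Set (Vec d)) (𝒢 : Set (Vec dX → ℝ))
    (Ybar : ℝ) : Prop :=
  ∃ A V : ℝ, 0 < A ∧ 0 < V ∧ ∀ j,
    PolyCovering (momentClass m Θ 𝒢 Ybar j) A V ∧
    PolyCovering ((fun f z => f z ^ 2) '' momentClass m Θ 𝒢 Ybar j) A V

/-! ### The conditions of the theorem -/

/-- The conditions on the function `S : ℝ^{d_Y} → ℝ₊`. -/
structure SCondition (S : Vec dY → ℝ) : Prop where
  nonneg : ∀ t, 0 ≤ S t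
  pos_iff : ∀ t, 0 < S t ↔ ∃ j, t j < 0
  growth : ∃ K₁ K₂ : ℝ, 0 < K₁ ∧ 0 < K₂ ∧ ∀ c : ℝ, 0 < c → ∀ t : Vec dY,
    (c ≤ S t → ∃ j, t j ≤ -(c * K₁)) ∧ (S t ≤ c → ∀ j, -(c * K₂) ≤ t j)

/-- All points of the support of `X` have enough probability mass nearby. -/
def SupportCondition (P : Measure (Vec dX × 𝒲)) : Prop :=
  ∃ η > 0, ∃ ε₀ > 0, ∀ ε : ℝ, 0 < ε → ε ≤ ε₀ → ∀ x ∈ suppX P,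
    η ≤ (lawX P).real (Metric.closedBall x ε) / ε ^ dX

/-- The class of all translations and dilations of `k`. -/
def kernelClass (k : Vec dX → ℝ) : Set (Vec dX → ℝ) :=
  {g | ∃ x : Vec dX, ∃ h : ℝ, 0 < h ∧ g = dilate k x h}

/-- The conditions on the kernel `k`. -/
structure KernelCondition (m : 𝒲 → Vec d → Vec dY) (Θ : Set (Vec d)) (Ybar : ℝ)
    (k : Vec dX → ℝ) : Prop where
  measurable : Measurable k
  nonneg : ∀ t, 0 ≤ k t
  integrable : Integrable k
  integral_eq_one : ∫ t, k t = 1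
  bounded : ∃ kbar : ℝ, ∀ t, k t ≤ kbar
  square_integrable : MemLp k 2
  lower_bound : ∃ κ > 0, ∀ᶠ t in 𝓝 (0 : Vec dX), κ ≤ k t
  covering : CoveringCondition m Θ (kernelClass k) Ybar

/-- The weighted moment functions are bounded: `|m_j(W, θ) g(X)| ≤ Ybar` almost surely. -/
def BoundedCondition (P : Measure (Vec dX × 𝒲)) (m : 𝒲 → Vec d → Vec dY) (Θ : Set (Vec d))
    (𝒢 : Set (Vec dX → ℝ)) (Ybar : ℝ) : Prop :=
  ∀ θ ∈ Θ, ∀ g ∈ 𝒢, ∀ j, ∀ᵐ z ∂P, |m z.2 θ j * g z.1| ≤ Ybar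

/-- The contact set of `θ`: the points `x` of the support of `X` with `min_k mbar_k(θ, x) = 0`. -/
def contactSet (P : Measure (Vec dX × 𝒲)) (mbar : Vec d → Vec dX → Vec dY) (θ : Vec d) :
    Set (Vec dX) :=
  {x ∈ suppX P | IsLeast (range fun k => mbar θ x k) 0}

/-- The conditions on the conditional mean on the ball `B` of radius `r` about `θ₀`. -/
structure LocalSmoothness (P : Measure (Vec dX × 𝒲)) (mbar : Vec d → Vec dX → Vec dY)
    (Θ₀ : Set (Vec d)) (α : ℝ) (θ₀ : Vec d) (r : ℝ) : Prop where
  /-- The moment inequalities that define `Θ₀` hold at every point of the support. -/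
  nonneg_on_support : ∀ θ ∈ Θ₀ ∩ Metric.ball θ₀ r, ∀ x ∈ suppX P, ∀ j, 0 ≤ mbar θ x j
  /-- The minimum over the support is attained (automatic for continuous `mbar θ`). -/
  min_attained : ∀ θ ∈ frontier Θ₀ ∩ Metric.ball θ₀ r, ∀ j,
    ∃ x ∈ suppX P, IsMinOn (fun x => mbar θ x j) (suppX P) x
  /-- Differentiability in `θ` with bounded derivative. -/
  differentiable : ∀ θ ∈ Metric.ball θ₀ r, ∀ x ∈ suppX P,
    DifferentiableAt ℝ (fun θ' => mbar θ' x) θ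
  deriv_bounded : ∃ M : ℝ, ∀ θ ∈ Metric.ball θ₀ r, ∀ x ∈ suppX P,
    ‖fderiv ℝ (fun θ' => mbar θ' x) θ‖ ≤ M
  /-- Away from a contact point the conditional mean moves at least like `‖x - x₀‖^α`. -/
  growth : ∃ η > 0, ∀ θ ∈ frontier Θ₀ ∩ Metric.ball θ₀ r, ∀ x₀ ∈ contactSet P mbar θ,
    ∀ x ∈ suppX P, ∀ j, η * min (‖x - x₀‖ ^ α) η ≤ |mbar θ x j - mbar θ x₀ j|
  /-- The number of contact points is bounded. -/
  contact_card : ∃ N : ℕ, ∀ θ ∈ frontier Θ₀ ∩ Metric.ball θ₀ r,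
    (contactSet P mbar θ).encard ≤ N

/-- The upper bound (with exponent `α`) on the smoothness of the data generating process. -/
structure SmoothnessUpperCondition (P : Measure (Vec dX × 𝒲)) (m : 𝒲 → Vec d → Vec dY)
    (Θ : Set (Vec d)) (mbar : Vec d → Vec dX → Vec dY) (α : ℝ) : Prop where
  smooth : ∃ θ₀ ∈ frontier (identifiedSet P m Θ), ∃ r > 0, Metric.ball θ₀ r ⊆ Θ ∧
    LocalSmoothness P mbar (identifiedSet P m Θ) α θ₀ r
  bounded_support : Bornology.IsBounded (suppX P)
  bounded_density : ∃ f : Vec dX → ℝ, Measurable f ∧ (∃ fbar : ℝ, ∀ x, f x ≤ fbar) ∧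
    lawX P = volume.withDensity fun x => ENNReal.ofReal (f x)

/-- The events `E n` hold with probability approaching one. For measurable events this says
`μ (E n) → 1`; in general the outer measure of the complement tends to zero, so that `E n`
contains measurable events whose probabilities tend to one. -/
def WithProbToOne {Ω : Type*} [MeasurableSpace Ω] (μ : Measure Ω) (E : ℕ → Set Ω) : Prop :=
  Tendsto (fun n => μ (E n)ᶜ) atTop (𝓝 0)

end CondMoment

end

/-! Smoothing bias lets the set estimate reach outside the identified set. Projecting a nearby
exterior point onto the closure of the identified set gives a boundary point `θb` and a segment
along which the distance to the identified set grows at unit speed (`exists_segment_leaving`). At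
`θb` each component of `mbar` is nonnegative on the support and grows at least like `‖x - x₀‖ ^ α`
near a zero minimum. As the density of `X` is bounded, little mass lies within a small multiple of
`h` of `x₀`, so kernel averages of `mbar θb` exceed a multiple of `h ^ α`, uniformly in `x`
(`exists_le_integral_mul_dilate`). Since `mbar` is Lipschitz in `θ`, a move of length `t` costs at
most a multiple of `t`.

With `t = ε / min (scale, h ^ (-α))` one has `t ≤ ε / scale + ε * h ^ α`: the bias pays for the
second term and sampling noise of order `1 / scale` dominates the first. It remains to bound the
noise. For each `n` the point on the segment is deterministic, so only uniformity in `x` is needed.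
The numerators are controlled by symmetrization, Hoeffding's inequality and the covering numbers
(`measure_exists_kernel_sum_lt_le`), the denominators by a Chernoff bound over a finite cover of the
support (`measure_exists_kernel_density_lt_le`). With high probability the point then lies in the
estimate for every critical value at least `c`, which forces the Hausdorff distance to be at least
`t`.

The kernel is only measurable, so suprema over `x` cannot be reduced to countable ones. The
measurable projection theorem supplies the null measurability that symmetrization uses. -/

namespace MeasureTheory

/-! ### Universal measurability of analytic sets and measurable projection. -/

/-- In the Baire space, a compact box contained in an open set has a finite-dimensional cylinder
of the same bounds contained in that open set. -/
theorem exists_cylinder_subset_of_box_subset (b : ℕ → ℕ) {O : Set (ℕ → ℕ)} (hO : IsOpen O)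
    (hb : {x : ℕ → ℕ | ∀ i, x i ≤ b i} ⊆ O) : ∃ k, {x : ℕ → ℕ | ∀ i < k, x i ≤ b i} ⊆ O := by
  by_contra! hcon
  simp only [not_subset] at hcon
  choose x hxU hxO using hcon
  have hK : IsCompact {x : ℕ → ℕ | ∀ i, x i ≤ b i} := by
    have : {x : ℕ → ℕ | ∀ i, x i ≤ b i} = Set.univ.pi fun i => Iic (b i) := by
      ext; simp [Pi.le_def]
    rw [this]
    exact isCompact_univ_pi fun i => (Set.finite_Iic _).isCompact
  -- Truncation at `b` moves `x k` into the compact box and leaves its first `k` coordinates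
  -- unchanged, so along `φ` the truncated and original sequences have the same limit.
  obtain ⟨y, hy, φ, hφ, hlim⟩ := hK.tendsto_subseq (x := fun k i => min (x k i) (b i))
    (fun k i => min_le_right _ _)
  have hlim' : Tendsto (fun k => x (φ k)) atTop (𝓝 y) := by
    rw [tendsto_pi_nhds] at hlim ⊢
    intro i
    refine (hlim i).congr' ?_
    filter_upwards [eventually_gt_atTop i] with k hk
    exact min_eq_left (hxU (φ k) i (hk.trans_le (hφ.id_le k)))
  obtain ⟨k, hk⟩ := (hlim'.eventually (hO.mem_nhds (hb hy))).exists
  exact hxO _ hk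

/-- Approximation of analytic sets by compact subsets with respect to a finite measure. -/
theorem AnalyticSet.exists_isCompact_subset_measure_le {α : Type*} [TopologicalSpace α]
    [MeasurableSpace α] {s : Set α} (hs : AnalyticSet s) (μ : Measure α) [IsFiniteMeasure μ]
    [μ.OuterRegular] {ε : ℝ≥0∞} (hε : ε ≠ 0) :
    ∃ K ⊆ s, IsCompact K ∧ μ s ≤ μ K + ε := by
  rw [AnalyticSet] at hs
  rcases hs with rfl | ⟨f, hf, rfl⟩
  · exact ⟨∅, subset_rfl, isCompact_empty, by simp⟩
  obtain ⟨δ, hδ, hδε⟩ := ENNReal.exists_pos_sum_of_countable' hε ℕ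
  -- Continuity from below holds for arbitrary sets, so bounding one more coordinate can be made to
  -- cost at most `δ k`.
  have step : ∀ (U : Set (ℕ → ℕ)) (k : ℕ), ∃ N,
      μ (f '' U) ≤ μ (f '' (U ∩ {x | x k ≤ N})) + δ k := by
    intro U k
    have hU : f '' U = ⋃ N : ℕ, f '' (U ∩ {x | x k ≤ N}) := by
      rw [← image_iUnion, ← inter_iUnion]
      congr 1
      refine (inter_eq_left.2 fun x _ => mem_iUnion.2 ⟨x k, le_refl (x k)⟩).symm
    have hmono : Monotone fun N : ℕ => f '' (U ∩ {x | x k ≤ N}) := fun a b hab =>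
      image_mono (inter_subset_inter_right _ fun x (hx : x k ≤ a) => hx.trans hab)
    have hlim := tendsto_measure_iUnion_atTop (μ := μ) hmono
    rw [← hU] at hlim
    rcases eq_or_ne (μ (f '' U)) 0 with h0 | h0
    · exact ⟨0, by simp [h0]⟩
    obtain ⟨N, hN⟩ := (hlim.eventually (lt_mem_nhds
      (ENNReal.sub_lt_self (measure_ne_top μ _) h0 (hδ k).ne'))).exists
    exact ⟨N, tsub_le_iff_right.1 hN.le⟩
  choose N hN using step
  let U : ℕ → Set (ℕ → ℕ) := fun k => Nat.rec Set.univ (fun k V => V ∩ {x | x k ≤ N V k}) k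
  let b : ℕ → ℕ := fun k => N (U k) k
  have hU : ∀ k, U k = {x : ℕ → ℕ | ∀ i < k, x i ≤ b i} := by
    intro k
    induction k with
    | zero => ext; simp [U]
    | succ k ih =>
      have : U (k + 1) = U k ∩ {x | x k ≤ b k} := rfl
      rw [this, ih]
      ext x
      simp only [mem_inter_iff, mem_ofPred_eq, Nat.lt_succ_iff_lt_or_eq, or_imp,
        forall_and, forall_eq]
  have hμU : ∀ k, μ (range f) ≤ μ (f '' U k) + ∑ i ∈ Finset.range k, δ i := by
    intro k
    induction k with
    | zero => simp [U, image_univ]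
    | succ k ih =>
      rw [Finset.sum_range_succ]
      refine ih.trans ?_
      calc μ (f '' U k) + ∑ i ∈ Finset.range k, δ i
          ≤ μ (f '' U (k + 1)) + δ k + ∑ i ∈ Finset.range k, δ i := by
            gcongr; exact hN (U k) k
        _ = _ := by ring
  have hK : IsCompact {x : ℕ → ℕ | ∀ i, x i ≤ b i} := by
    have : {x : ℕ → ℕ | ∀ i, x i ≤ b i} = Set.univ.pi fun i => Iic (b i) := by
      ext; simp [Pi.le_def]
    rw [this]
    exact isCompact_univ_pi fun i => (Set.finite_Iic _).isCompact
  refine ⟨f '' {x | ∀ i, x i ≤ b i}, image_subset_range _ _, hK.image hf, ?_⟩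
  refine le_of_forall_gt fun c hc => ?_
  have hc' : μ (f '' {x | ∀ i, x i ≤ b i}) < c - ε := by
    rwa [lt_tsub_iff_right]
  -- The images of the decreasing cylinders `U k` need not intersect in the image of the box. Outer
  -- regularity avoids this: the preimage of an open neighbourhood of that image already contains
  -- some `U k`.
  obtain ⟨O, hKO, hO, hOc⟩ := Set.exists_isOpen_lt_of_lt _ _ hc'
  obtain ⟨k, hk⟩ := exists_cylinder_subset_of_box_subset b (hO.preimage hf)
    (image_subset_iff.1 hKO)
  rw [← hU] at hk
  calc μ (range f) ≤ μ (f '' U k) + ∑ i ∈ Finset.range k, δ i := hμU k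
    _ ≤ μ O + ε := by
      gcongr
      · exact image_subset_iff.2 hk
      · exact (ENNReal.sum_le_tsum _).trans hδε.le
    _ < c := lt_tsub_iff_right.1 hOc

/-- Analytic sets are universally measurable. -/
theorem AnalyticSet.nullMeasurableSet {α : Type*} [TopologicalSpace α] [T2Space α]
    [MeasurableSpace α] [OpensMeasurableSpace α] {s : Set α} (hs : AnalyticSet s)
    (μ : Measure α) [IsFiniteMeasure μ] [μ.OuterRegular] : NullMeasurableSet s μ := by
  have h : ∀ n : ℕ, ∃ K ⊆ s, IsCompact K ∧ μ s ≤ μ K + ((n : ℝ≥0∞) + 1)⁻¹ := fun n =>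
    hs.exists_isCompact_subset_measure_le μ (by simp)
  choose K hKs hK hμ using h
  have hm : MeasurableSet (⋃ n, K n) := .iUnion fun n => (hK n).measurableSet
  refine ⟨⋃ n, K n, hm, (ae_eq_of_subset_of_measure_ge (iUnion_subset hKs) ?_
    hm.nullMeasurableSet (measure_ne_top μ s)).symm⟩
  have hlim : Tendsto (fun n : ℕ => μ (⋃ n, K n) + ((n : ℝ≥0∞) + 1)⁻¹) atTop
      (𝓝 (μ (⋃ n, K n) + 0)) := by
    refine tendsto_const_nhds.add ?_
    have := (tendsto_add_atTop_iff_nat 1).2 ENNReal.tendsto_inv_nat_nhds_zero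
    simpa using this
  rw [add_zero] at hlim
  exact ge_of_tendsto' hlim fun n => (hμ n).trans (by gcongr; exact subset_iUnion K n)

/-- A measurable subset of `Y × X` is the preimage of a measurable subset of `(ℕ → Bool) × X` under
a measurable map acting on the first factor. -/
theorem exists_measurable_preimage_eq {Y X : Type*} [MeasurableSpace Y] [MeasurableSpace X]
    {D : Set (Y × X)} (hD : MeasurableSet D) :
    ∃ (g : Y → ℕ → Bool) (D' : Set ((ℕ → Bool) × X)), Measurable g ∧ MeasurableSet D' ∧
      D = Prod.map g id ⁻¹' D' := by
  classical
  induction D, hD using MeasurableSpace.induction_on_inter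
    (generateFrom_prod (α := Y) (β := X)).symm isPiSystem_prod with
  | empty => exact ⟨fun _ _ => true, ∅, measurable_const, .empty, by simp⟩
  | basic t ht =>
    obtain ⟨A, hA, B, hB, rfl⟩ := ht
    refine ⟨fun y _ => decide (y ∈ A), {p | p.1 0 = true} ∩ {p | p.2 ∈ B}, ?_, ?_, ?_⟩
    · refine measurable_pi_lambda _ fun _ => ?_
      exact measurable_to_bool (by simpa [preimage] using hA)
    · refine MeasurableSet.inter ?_ (measurable_snd hB)
      exact measurableSet_eq_fun ((measurable_pi_apply 0).comp measurable_fst) measurable_const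
    · ext ⟨y, x⟩; simp
  | compl t _ ih =>
    obtain ⟨g, D', hg, hD', rfl⟩ := ih
    exact ⟨g, D'ᶜ, hg, hD'.compl, rfl⟩
  | iUnion f _ _ ih =>
    choose g D' hg hD' hf using ih
    -- The countably many codes are interleaved into one sequence of bits by the pairing function.
    refine ⟨fun y n => g n.unpair.1 y n.unpair.2,
      ⋃ i, (fun p : (ℕ → Bool) × X => ((fun j => p.1 (Nat.pair i j)), p.2)) ⁻¹' D' i, ?_, ?_, ?_⟩
    · exact measurable_pi_lambda _ fun n => (measurable_pi_apply _).comp (hg _)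
    · refine .iUnion fun i => (hD' i).preimage ?_
      refine Measurable.prodMk (measurable_pi_lambda _ fun j => ?_) measurable_snd
      exact (measurable_pi_apply _).comp measurable_fst
    · ext ⟨y, x⟩
      simp only [mem_iUnion, mem_preimage, Prod.map, id, Nat.unpair_pair]
      refine exists_congr fun i => ?_
      rw [hf i]; rfl

/-- **Measurable projection theorem.** The projection along a standard Borel space of a measurable
set is measurable with respect to the completion of every finite measure. -/
theorem nullMeasurableSet_image_fst {Y X : Type*} [MeasurableSpace Y] [MeasurableSpace X]
    [StandardBorelSpace X] {D : Set (Y × X)} (hD : MeasurableSet D) (μ : Measure Y)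
    [IsFiniteMeasure μ] : NullMeasurableSet (Prod.fst '' D) μ := by
  obtain ⟨g, D', hg, hD', rfl⟩ := exists_measurable_preimage_eq hD
  have h1 : Prod.fst '' (Prod.map g (id : X → X) ⁻¹' D') = g ⁻¹' (Prod.fst '' D') := by
    ext y
    simp only [mem_image, mem_preimage, Prod.exists, Prod.map, id, exists_and_right,
      exists_eq_right]
  rw [h1]
  -- After coding, the first factor is the Cantor space, so the projection is analytic although `Y`
  -- carries no topology.
  have h2 : AnalyticSet (Prod.fst '' D') := hD'.analyticSet_image measurable_fst
  have : IsFiniteMeasure (μ.map g) := Measure.isFiniteMeasure_map μ g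
  exact (h2.nullMeasurableSet (μ.map g)).preimage (hg.quasiMeasurePreserving μ)

end MeasureTheory

/-! ### Symmetrization by random exchanges, and counting of sign patterns. -/

/-- Exchange the two entries of the pairs `p i` with `σ i = true`. -/
def swapAt {ι 𝒵 : Type*} (σ : ι → Bool) (p : ι → 𝒵 × 𝒵) (i : ι) : 𝒵 × 𝒵 :=
  bif σ i then (p i).swap else p i

section Symmetrization

variable {ι 𝒵 : Type*} [Fintype ι] [MeasurableSpace 𝒵]

/-- The two entries of each pair are i.i.d. and the pairs are independent, so exchanging within any
fixed set of pairs leaves the law unchanged. -/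
theorem measurePreserving_swapAt (P : Measure 𝒵) [IsProbabilityMeasure P] (σ : ι → Bool) :
    MeasurePreserving (swapAt σ) (Measure.pi fun _ : ι => P.prod P)
      (Measure.pi fun _ : ι => P.prod P) := by
  refine measurePreserving_pi (fun _ : ι => P.prod P) (fun _ : ι => P.prod P)
    (f := fun i q => bif σ i then q.swap else q) fun i => ?_
  cases σ i
  · exact MeasurePreserving.id _
  · exact Measure.measurePreserving_swap

open Classical in
/-- A set of paired samples whose elements leave it under most exchanges has small probability. -/
theorem measure_le_of_card_swapAt_le (P : Measure 𝒵) [IsProbabilityMeasure P]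
    {E : Set (ι → 𝒵 × 𝒵)} (hE : NullMeasurableSet E (Measure.pi fun _ : ι => P.prod P)) {δ : ℝ}
    (hδ : ∀ p, ((Finset.univ.filter fun σ : ι → Bool => swapAt σ p ∈ E).card : ℝ) ≤
      2 ^ Fintype.card ι * δ) :
    (Measure.pi fun _ : ι => P.prod P) E ≤ ENNReal.ofReal δ := by
  set M := Measure.pi fun _ : ι => P.prod P
  have hpre : ∀ σ : ι → Bool, NullMeasurableSet (swapAt σ ⁻¹' E) M := fun σ =>
    hE.preimage (measurePreserving_swapAt P σ).quasiMeasurePreserving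
  -- Each of the `2 ^ card ι` exchanges preserves `M`, so the preimages of `E` all have measure `M
  -- E`; under the integral their indicators count exchanges.
  have h1 : (2 : ℝ≥0∞) ^ Fintype.card ι * M E =
      ∫⁻ p, ∑ σ : ι → Bool, (swapAt σ ⁻¹' E).indicator (fun _ => (1 : ℝ≥0∞)) p ∂M := by
    rw [lintegral_finsetSum' _ fun σ _ => aemeasurable_const.indicator₀ (hpre σ)]
    have : ∀ σ : ι → Bool,
        ∫⁻ p, (swapAt σ ⁻¹' E).indicator (fun _ => (1 : ℝ≥0∞)) p ∂M = M E := fun σ => by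
      rw [lintegral_indicator_const₀ (hpre σ), one_mul]
      exact (measurePreserving_swapAt P σ).measure_preimage hE
    simp [this]
  have h2 : ∀ p, ∑ σ : ι → Bool, (swapAt σ ⁻¹' E).indicator (fun _ => (1 : ℝ≥0∞)) p ≤
      2 ^ Fintype.card ι * ENNReal.ofReal δ := by
    intro p
    have : ∑ σ : ι → Bool, (swapAt σ ⁻¹' E).indicator (fun _ => (1 : ℝ≥0∞)) p =
        (Finset.univ.filter fun σ : ι → Bool => swapAt σ p ∈ E).card := by
      rw [Finset.card_filter]
      push_cast
      refine Finset.sum_congr rfl fun σ _ => ?_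
      simp [indicator, mem_preimage]
    rw [this]
    calc (((Finset.univ.filter fun σ : ι → Bool => swapAt σ p ∈ E).card : ℕ) : ℝ≥0∞)
        = ENNReal.ofReal ((Finset.univ.filter fun σ : ι → Bool => swapAt σ p ∈ E).card : ℝ) := by
          rw [ENNReal.ofReal_natCast]
      _ ≤ ENNReal.ofReal (2 ^ Fintype.card ι * δ) := ENNReal.ofReal_le_ofReal (hδ p)
      _ = _ := by
          rw [ENNReal.ofReal_mul (by positivity), ENNReal.ofReal_pow (by norm_num)]
          simp
  have h3 : (2 : ℝ≥0∞) ^ Fintype.card ι * M E ≤ 2 ^ Fintype.card ι * ENNReal.ofReal δ := by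
    rw [h1]
    refine (lintegral_mono h2).trans ?_
    simp [M]
  exact (ENNReal.mul_le_mul_iff_right (by simp) (by simp)).1 h3

open Classical in
/-- **Symmetrization.** If every sample with the property `A` for some index forms, with probability
at least one half, with an independent second sample a pair with the property `B` for that index,
and if few exchanges of a pair of samples have the property `B` for some index, then the property
`A` for some index is unlikely. -/
theorem measure_image_fst_le_of_symmetrization {T : Type*} [MeasurableSpace T]
    [StandardBorelSpace T] (P : Measure 𝒵) [IsProbabilityMeasure P]
    (A : Set ((ι → 𝒵) × T)) {B : Set ((ι → 𝒵 × 𝒵) × T)} (hB : MeasurableSet B)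
    (hAB : ∀ z x, (z, x) ∈ A →
      2⁻¹ ≤ (Measure.pi fun _ : ι => P) {z' | ((fun i => (z i, z' i)), x) ∈ B}) {δ : ℝ}
    (hδ : ∀ p, ((Finset.univ.filter fun σ : ι → Bool => ∃ x, (swapAt σ p, x) ∈ B).card : ℝ) ≤
      2 ^ Fintype.card ι * δ) :
    (Measure.pi fun _ : ι => P) (Prod.fst '' A) ≤ 2 * ENNReal.ofReal δ := by
  set M := Measure.pi fun _ : ι => P.prod P with hM
  set E : Set (ι → 𝒵 × 𝒵) := Prod.fst '' B with hE
  have hME : M E ≤ ENNReal.ofReal δ := by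
    refine measure_le_of_card_swapAt_le P (nullMeasurableSet_image_fst hB _) fun p => ?_
    refine le_trans (le_of_eq ?_) (hδ p)
    congr 2
    ext σ
    simp
  -- Fubini is applied to a measurable hull of `E`, which has the same measure.
  set H := toMeasurable M E
  have hH : MeasurableSet H := measurableSet_toMeasurable _ _
  have hpres := measurePreserving_arrowProdEquivProdArrow 𝒵 𝒵 ι (fun _ => P) (fun _ => P)
  let e := MeasurableEquiv.arrowProdEquivProdArrow 𝒵 𝒵 ι
  have hH' : MeasurableSet (e.symm ⁻¹' H) := e.symm.measurable hH
  have h1 : ((Measure.pi fun _ : ι => P).prod (Measure.pi fun _ : ι => P)) (e.symm ⁻¹' H) =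
      M E := by
    rw [(hpres.symm e).measure_preimage_equiv, measure_toMeasurable]
  have h2 : Prod.fst '' A ⊆ {z | (2⁻¹ : ℝ≥0∞) ≤
      (Measure.pi fun _ : ι => P) (Prod.mk z ⁻¹' (e.symm ⁻¹' H))} := by
    rintro _ ⟨⟨z, x⟩, hzx, rfl⟩
    refine (hAB z x hzx).trans (measure_mono fun z' hz' => ?_)
    exact subset_toMeasurable M E ⟨_, hz', rfl⟩
  have h3 := mul_meas_ge_le_lintegral (μ := Measure.pi fun _ : ι => P)
    (measurable_measure_prodMk_left (ν := Measure.pi fun _ : ι => P) hH') 2⁻¹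
  rw [← Measure.prod_apply hH', h1] at h3
  calc (Measure.pi fun _ : ι => P) (Prod.fst '' A)
      ≤ _ := measure_mono h2
    _ = 2 * (2⁻¹ * (Measure.pi fun _ : ι => P) {z | (2⁻¹ : ℝ≥0∞) ≤
          (Measure.pi fun _ : ι => P) (Prod.mk z ⁻¹' (e.symm ⁻¹' H))}) := by
        rw [← mul_assoc, ENNReal.mul_inv_cancel (by simp) (by simp), one_mul]
    _ ≤ 2 * ENNReal.ofReal δ := by gcongr; exact h3.trans hME

open Classical in
/-- **Hoeffding's inequality** for Rademacher sums, as a count of sign patterns. -/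
theorem card_filter_le_signedSum_le (a : ι → ℝ) {u V : ℝ} (hu : 0 ≤ u) (hV : 0 < V)
    (ha : ∑ i, a i ^ 2 ≤ V) :
    ((Finset.univ.filter fun σ : ι → Bool => u ≤ ∑ i, bif σ i then -a i else a i).card : ℝ) ≤
      2 ^ Fintype.card ι * Real.exp (-u ^ 2 / (2 * V)) := by
  set s := Finset.univ.filter fun σ : ι → Bool => u ≤ ∑ i, bif σ i then -a i else a i
  -- This is the minimizer of `l ^ 2 * V / 2 - l * u`, the exponent in the Chernoff bound.
  set l := u / V
  have hl : 0 ≤ l := by positivity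
  have h1 : (s.card : ℝ) * Real.exp (l * u) ≤
      ∑ σ : ι → Bool, ∏ i, Real.exp (l * bif σ i then -a i else a i) := by
    calc (s.card : ℝ) * Real.exp (l * u) = ∑ σ ∈ s, Real.exp (l * u) := by simp
      _ ≤ ∑ σ ∈ s, ∏ i, Real.exp (l * bif σ i then -a i else a i) := by
        refine Finset.sum_le_sum fun σ hσ => ?_
        rw [← Real.exp_sum, ← Finset.mul_sum]
        gcongr
        exact (Finset.mem_filter.1 hσ).2
      _ ≤ _ := Finset.sum_le_sum_of_subset_of_nonneg (Finset.subset_univ _)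
        fun σ _ _ => Finset.prod_nonneg fun i _ => (Real.exp_pos _).le
  have h2 : ∑ σ : ι → Bool, ∏ i, Real.exp (l * bif σ i then -a i else a i) =
      ∏ i, (2 * Real.cosh (l * a i)) := by
    have := Finset.prod_univ_sum (fun _ : ι => (Finset.univ : Finset Bool))
      (fun i b => Real.exp (l * bif b then -a i else a i))
    rw [Fintype.piFinset_univ] at this
    rw [← this]
    refine Finset.prod_congr rfl fun i _ => ?_
    simp only [Fintype.sum_bool, cond_true, cond_false, Real.cosh_eq]
    rw [mul_neg]; ring
  have h3 : ∏ i, (2 * Real.cosh (l * a i)) ≤ 2 ^ Fintype.card ι * Real.exp (l ^ 2 * V / 2) := by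
    calc ∏ i, (2 * Real.cosh (l * a i)) ≤ ∏ i, (2 * Real.exp ((l * a i) ^ 2 / 2)) := by
          refine Finset.prod_le_prod (fun i _ => by positivity) fun i _ => ?_
          gcongr
          exact Real.cosh_le_exp_half_sq _
      _ = 2 ^ Fintype.card ι * Real.exp (l ^ 2 * (∑ i, a i ^ 2) / 2) := by
          rw [Finset.prod_mul_distrib, ← Real.exp_sum, Finset.prod_const, Finset.card_univ,
            Finset.mul_sum, Finset.sum_div]
          simp_rw [mul_pow]
      _ ≤ _ := by gcongr
  have h4 : l ^ 2 * V / 2 = l * u + -u ^ 2 / (2 * V) := by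
    simp only [l]; field_simp; ring
  rw [h4, Real.exp_add] at h3
  have h5 := h1.trans (h2.le.trans h3)
  have := Real.exp_pos (l * u)
  refine le_of_mul_le_mul_right (h5.trans (le_of_eq (by ring))) this

open Classical in
/-- Union bound over a finite set of approximating elements, with one representative for each. -/
theorem card_filter_exists_le_of_net {S T γ : Type*} [Fintype S] {E E' : S → T → Prop}
    {good : T → Prop} {r : T → γ → Prop} (G : Finset γ) {N m : ℝ} (hm : 0 ≤ m)
    (hG : (G.card : ℝ) ≤ N) (hr : ∀ x, good x → ∃ g ∈ G, r x g) (hE : ∀ s x, E s x → good x)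
    (hE' : ∀ x y g, good x → good y → r x g → r y g → ∀ s, E s x → E' s y)
    (hcard : ∀ y, good y → ((Finset.univ.filter fun s => E' s y).card : ℝ) ≤ m) :
    ((Finset.univ.filter fun s => ∃ x, E s x).card : ℝ) ≤ N * m := by
  -- Centers need not belong to the class, so each is replaced by a good element related to it.
  -- Comparison through the center is why `hE'` allows a weakened event `E'`.
  let f : γ → Finset S := fun g =>
    if h : ∃ y, good y ∧ r y g then Finset.univ.filter fun s => E' s h.choose else ∅
  have hf : ∀ g, ((f g).card : ℝ) ≤ m := by
    intro g
    by_cases h : ∃ y, good y ∧ r y g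
    · simp only [f, dif_pos h]
      exact hcard _ h.choose_spec.1
    · simpa [f, dif_neg h] using hm
  have hsub : (Finset.univ.filter fun s => ∃ x, E s x) ⊆ G.biUnion f := by
    intro s hs
    obtain ⟨x, hx⟩ := (Finset.mem_filter.1 hs).2
    obtain ⟨g, hgG, hg⟩ := hr x (hE s x hx)
    refine Finset.mem_biUnion.2 ⟨g, hgG, ?_⟩
    have h : ∃ y, good y ∧ r y g := ⟨x, hE s x hx, hg⟩
    simp only [f, dif_pos h, Finset.mem_filter, Finset.mem_univ, true_and]
    exact hE' x _ g (hE s x hx) h.choose_spec.1 hg h.choose_spec.2 s hx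
  calc ((Finset.univ.filter fun s => ∃ x, E s x).card : ℝ)
      ≤ ((G.biUnion f).card : ℝ) := by exact_mod_cast Finset.card_le_card hsub
    _ ≤ ∑ g ∈ G, ((f g).card : ℝ) := by exact_mod_cast Finset.card_biUnion_le
    _ ≤ ∑ _g ∈ G, m := Finset.sum_le_sum fun g _ => hf g
    _ = G.card * m := by simp
    _ ≤ N * m := by gcongr

end Symmetrization

/-! ### Sums over paired samples and their `ℓ₁` continuity. -/

section PairedSamples

variable {ι 𝒵 : Type*} [Fintype ι]

/-- An exchange flips the sign of one difference, which turns the gap between the two samples into a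
Rademacher sum once the pairs are fixed. -/
theorem sum_swapAt_sub (σ : ι → Bool) (p : ι → 𝒵 × 𝒵) (f : 𝒵 → ℝ) :
    ∑ i, f (swapAt σ p i).1 - ∑ i, f (swapAt σ p i).2 =
      ∑ i, bif σ i then -(f (p i).1 - f (p i).2) else f (p i).1 - f (p i).2 := by
  rw [← Finset.sum_sub_distrib]
  refine Finset.sum_congr rfl fun i _ => ?_
  unfold swapAt
  cases σ i <;> simp

theorem sum_swapAt_add (σ : ι → Bool) (p : ι → 𝒵 × 𝒵) (f : 𝒵 → ℝ) :
    ∑ i, f (swapAt σ p i).1 + ∑ i, f (swapAt σ p i).2 = ∑ i, f (p i).1 + ∑ i, f (p i).2 := by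
  rw [← Finset.sum_add_distrib, ← Finset.sum_add_distrib]
  refine Finset.sum_congr rfl fun i _ => ?_
  unfold swapAt
  cases σ i <;> simp [add_comm]

theorem abs_signedSum_sub_le (σ : ι → Bool) (a a' : ι → ℝ) :
    |∑ i, (bif σ i then -a i else a i) - ∑ i, (bif σ i then -a' i else a' i)| ≤
      ∑ i, |a i - a' i| := by
  rw [← Finset.sum_sub_distrib]
  refine (Finset.abs_sum_le_sum_abs _ _).trans (Finset.sum_le_sum fun i _ => ?_)
  cases σ i
  · simp
  · simp only [cond_true]
    rw [← abs_neg]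
    exact le_of_eq (by congr 1; ring)

/-- The `ℓ₁` distance of two functions on a pair of samples, bounded through a common center. -/
theorem sum_abs_pair_le (p : ι → 𝒵 × 𝒵) {f f' g : 𝒵 → ℝ} {τ : ℝ}
    (h : ∑ i, (|f (p i).1 - g (p i).1| + |f (p i).2 - g (p i).2|) ≤ τ)
    (h' : ∑ i, (|f' (p i).1 - g (p i).1| + |f' (p i).2 - g (p i).2|) ≤ τ) :
    ∑ i, (|f (p i).1 - f' (p i).1| + |f (p i).2 - f' (p i).2|) ≤ 2 * τ := by
  have : ∑ i, (|f (p i).1 - f' (p i).1| + |f (p i).2 - f' (p i).2|) ≤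
      ∑ i, ((|f (p i).1 - g (p i).1| + |f (p i).2 - g (p i).2|) +
        (|f' (p i).1 - g (p i).1| + |f' (p i).2 - g (p i).2|)) := by
    refine Finset.sum_le_sum fun i _ => ?_
    have h1 := abs_sub_le (f (p i).1) (g (p i).1) (f' (p i).1)
    have h2 := abs_sub_le (f (p i).2) (g (p i).2) (f' (p i).2)
    rw [abs_sub_comm (g (p i).1)] at h1
    rw [abs_sub_comm (g (p i).2)] at h2
    linarith
  refine this.trans ?_
  rw [Finset.sum_add_distrib]
  linarith

/-- The bound does not depend on `σ`, so one `ℓ₁` net of the pooled sample serves all exchanges at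
once. -/
theorem abs_signedSum_pair_sub_le (σ : ι → Bool) (p : ι → 𝒵 × 𝒵) (f f' : 𝒵 → ℝ) :
    |∑ i, (bif σ i then -(f (p i).1 - f (p i).2) else f (p i).1 - f (p i).2) -
        ∑ i, (bif σ i then -(f' (p i).1 - f' (p i).2) else f' (p i).1 - f' (p i).2)| ≤
      ∑ i, (|f (p i).1 - f' (p i).1| + |f (p i).2 - f' (p i).2|) := by
  refine (abs_signedSum_sub_le σ _ _).trans (Finset.sum_le_sum fun i _ => ?_)
  calc |f (p i).1 - f (p i).2 - (f' (p i).1 - f' (p i).2)|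
      = |(f (p i).1 - f' (p i).1) - (f (p i).2 - f' (p i).2)| := by congr 1; ring
    _ ≤ _ := abs_sub _ _

end PairedSamples

/-! ### Uniform one-sided deviation bounds for i.i.d. sums. -/

section MaximalInequalities

variable {ι 𝒵 T : Type*} [Fintype ι] [MeasurableSpace 𝒵] [MeasurableSpace T] [StandardBorelSpace T]

theorem integral_sum_comp_eval (P : Measure 𝒵) [IsProbabilityMeasure P] {f : 𝒵 → ℝ}
    (hf : Integrable f P) :
    ∫ z, ∑ i : ι, f (z i) ∂(Measure.pi fun _ : ι => P) = Fintype.card ι * ∫ z, f z ∂P := by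
  rw [integral_finsetSum]
  · have : ∀ i : ι, ∫ z, f (z i) ∂(Measure.pi fun _ : ι => P) = ∫ z, f z ∂P := fun i =>
      integral_comp_eval (μ := fun _ : ι => P) (i := i) hf.1
    simp [this]
  · intro i _
    exact (measurePreserving_eval (fun _ : ι => P) i).integrable_comp_of_integrable hf

/-- `s` is not assumed measurable, so only subadditivity is available. -/
theorem two_inv_le_of_measure_compl_le {Ω : Type*} [MeasurableSpace Ω] (μ : Measure Ω)
    [IsProbabilityMeasure μ] {s : Set Ω} (h : μ sᶜ ≤ 2⁻¹) : 2⁻¹ ≤ μ s := by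
  have h1 : 1 ≤ μ s + μ sᶜ := by
    rw [← measure_univ (μ := μ), ← union_compl_self s]
    exact measure_union_le _ _
  have h2 : (2 : ℝ≥0∞)⁻¹ + 2⁻¹ ≤ μ s + 2⁻¹ := by
    rw [ENNReal.inv_two_add_inv_two]
    exact h1.trans (by gcongr)
  exact (ENNReal.add_le_add_iff_right (by simp)).1 h2

/-- Markov's inequality for a sum over an i.i.d. sample. -/
theorem measure_le_sum_le (P : Measure 𝒵) [IsProbabilityMeasure P] {f : 𝒵 → ℝ}
    (hf : Integrable f P) (hf0 : 0 ≤ f) {v L r : ℝ} (hL : 0 < L) (hv : ∫ z, f z ∂P ≤ v)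
    (hr : Fintype.card ι * v ≤ r * L) :
    (Measure.pi fun _ : ι => P) {z | L ≤ ∑ i, f (z i)} ≤ ENNReal.ofReal r := by
  have h := mul_meas_ge_le_integral_of_nonneg (μ := Measure.pi fun _ : ι => P)
    (f := fun z => ∑ i, f (z i)) (.of_forall fun z => Finset.sum_nonneg fun i _ => hf0 _)
    (integrable_finsetSum _ fun i _ =>
      (measurePreserving_eval (fun _ : ι => P) i).integrable_comp_of_integrable hf) L
  rw [integral_sum_comp_eval P hf] at h
  have h2 : L * (Measure.pi fun _ : ι => P).real {z | L ≤ ∑ i, f (z i)} ≤ L * r := by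
    refine h.trans (le_trans ?_ (hr.trans (mul_comm _ _).le))
    gcongr
  rw [← ENNReal.ofReal_toReal (measure_ne_top _ _)]
  exact ENNReal.ofReal_le_ofReal (le_of_mul_le_mul_left h2 hL)

/-- Chebyshev's inequality for the lower deviations of a sum over an i.i.d. sample. -/
theorem measure_sum_le_sub_le (P : Measure 𝒵) [IsProbabilityMeasure P] {f : 𝒵 → ℝ}
    (hf : MemLp f 2 P) {v u r : ℝ} (hu : 0 < u) (hv : ∫ z, f z ^ 2 ∂P ≤ v)
    (hr : Fintype.card ι * v ≤ r * u ^ 2) :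
    (Measure.pi fun _ : ι => P) {z | ∑ i, f (z i) ≤ Fintype.card ι * (∫ z, f z ∂P) - u} ≤
      ENNReal.ofReal r := by
  have hL : MemLp (∑ i, fun z : ι → 𝒵 => f (z i)) 2 (Measure.pi fun _ : ι => P) :=
    memLp_finsetSum' _ fun i _ => hf.comp_measurePreserving (measurePreserving_eval _ i)
  have h := meas_ge_le_variance_div_sq hL hu
  rw [variance_sum_pi (μ := fun _ : ι => P) (X := fun _ => f) fun _ => hf] at h
  refine (measure_mono fun z hz => ?_).trans (h.trans (ENNReal.ofReal_le_ofReal ?_))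
  · have h1 : ∫ z, (∑ i, fun z : ι → 𝒵 => f (z i)) z ∂(Measure.pi fun _ : ι => P) =
        Fintype.card ι * ∫ z, f z ∂P := by
      simp only [Finset.sum_apply]
      exact integral_sum_comp_eval P (hf.integrable one_le_two)
    have hz' : ∑ i, f (z i) ≤ Fintype.card ι * (∫ z, f z ∂P) - u := hz
    change u ≤ |_ - _|
    rw [h1, Finset.sum_apply, abs_sub_comm]
    exact le_abs.2 (.inl (by linarith))
  · rw [div_le_iff₀ (by positivity), Finset.sum_const, Finset.card_univ, nsmul_eq_mul]
    refine le_trans ?_ hr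
    gcongr
    exact (variance_le_expectation_sq hf.1).trans hv

open Classical in
/-- Uniform upper bound, over a class of nonnegative functions, for sums over an i.i.d. sample. -/
theorem measure_exists_lt_sum_le (P : Measure 𝒵) [IsProbabilityMeasure P] {q : T → 𝒵 → ℝ}
    (hq : Measurable (Function.uncurry q)) (hq0 : ∀ x z, 0 ≤ q x z) {G : Set 𝒵}
    (hG : MeasurableSet G) (hPG : ∀ᵐ z ∂P, z ∈ G) {b : ℝ} (hb : 0 < b)
    (hqb : ∀ x, ∀ z ∈ G, q x z ≤ b) {v L N : ℝ} (hv : ∀ x, ∫ z, q x z ∂P ≤ v) (hL : 0 < L)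
    (hvL : 6 * (Fintype.card ι * v) ≤ L)
    (hcov : ∀ p : ι → 𝒵 × 𝒵, ∃ C : Finset (𝒵 → ℝ), (C.card : ℝ) ≤ N ∧ ∀ x, ∃ g ∈ C,
      ∑ i, (|q x (p i).1 - g (p i).1| + |q x (p i).2 - g (p i).2|) ≤ L / 16) :
    (Measure.pi fun _ : ι => P) {z | ∃ x, (∀ i, z i ∈ G) ∧ L < ∑ i, q x (z i)} ≤
      2 * ENNReal.ofReal (N * Real.exp (-L / (32 * b))) := by
  have hqx : ∀ x, Measurable (q x) := fun x => hq.of_uncurry_left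
  let A : Set ((ι → 𝒵) × T) := {a | (∀ i, a.1 i ∈ G) ∧ L < ∑ i, q a.2 (a.1 i)}
  let B : Set ((ι → 𝒵 × 𝒵) × T) := {a | ((∀ i, (a.1 i).1 ∈ G) ∧ ∀ i, (a.1 i).2 ∈ G) ∧
    L < ∑ i, q a.2 (a.1 i).1 ∧ 3 * ∑ i, q a.2 (a.1 i).2 ≤ L}
  have hA : {z | ∃ x, (∀ i, z i ∈ G) ∧ L < ∑ i, q x (z i)} = Prod.fst '' A := by
    ext z; simp [A]
  have hp1 : ∀ i : ι, Measurable fun a : (ι → 𝒵 × 𝒵) × T => (a.1 i).1 := fun i => by fun_prop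
  have hp2 : ∀ i : ι, Measurable fun a : (ι → 𝒵 × 𝒵) × T => (a.1 i).2 := fun i => by fun_prop
  have hB : MeasurableSet B := by
    refine .inter (.inter ?_ ?_) (.inter ?_ ?_)
    · have h : {a : (ι → 𝒵 × 𝒵) × T | ∀ i, (a.1 i).1 ∈ G} =
          ⋂ i, (fun a : (ι → 𝒵 × 𝒵) × T => (a.1 i).1) ⁻¹' G := by ext; simp
      have h' := MeasurableSet.iInter fun i => hp1 i hG
      rw [← h] at h'
      exact h'
    · have h : {a : (ι → 𝒵 × 𝒵) × T | ∀ i, (a.1 i).2 ∈ G} =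
          ⋂ i, (fun a : (ι → 𝒵 × 𝒵) × T => (a.1 i).2) ⁻¹' G := by ext; simp
      have h' := MeasurableSet.iInter fun i => hp2 i hG
      rw [← h] at h'
      exact h'
    · exact measurableSet_lt measurable_const (Finset.measurable_sum _ fun i _ =>
        hq.comp (measurable_snd.prodMk (hp1 i)))
    · exact measurableSet_le ((Finset.measurable_sum _ fun i _ =>
        hq.comp (measurable_snd.prodMk (hp2 i))).const_mul 3) measurable_const
  have hgood : ∀ᵐ z ∂(Measure.pi fun _ : ι => P), ∀ i, z i ∈ G := by
    rw [ae_all_iff]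
    exact fun i => (measurePreserving_eval (fun _ : ι => P) i).quasiMeasurePreserving.ae hPG
  rw [hA]
  refine measure_image_fst_le_of_symmetrization P A hB ?_ fun p => ?_
  · rintro z x ⟨hz, hzL⟩
    refine two_inv_le_of_measure_compl_le _ ?_
    have hint : Integrable (q x) P := by
      refine Integrable.of_bound (hqx x).aestronglyMeasurable b (hPG.mono fun z hz => ?_)
      rw [Real.norm_of_nonneg (hq0 x z)]
      exact hqb x z hz
    -- Markov's inequality: the independent second sample has sum below `L / 3` with probability at
    -- least one half.
    have hM := measure_le_sum_le (ι := ι) P hint (hq0 x) (L := L / 3) (r := 1 / 2) (by positivity)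
      (hv x) (by linarith)
    have h2 : ENNReal.ofReal (1 / 2) = 2⁻¹ := by
      rw [one_div, ENNReal.ofReal_inv_of_pos (by norm_num)]; simp
    rw [h2] at hM
    refine le_trans (measure_mono_ae ?_) hM
    filter_upwards [hgood] with z' hz' hzB
    by_contra hcon
    have hcon : ¬ (L / 3 ≤ ∑ i, q x (z' i)) := hcon
    exact hzB ⟨⟨hz, hz'⟩, hzL, by change 3 * ∑ i, q x (z' i) ≤ L; linarith [not_le.1 hcon]⟩
  · by_cases hpG : ∀ i, (p i).1 ∈ G ∧ (p i).2 ∈ G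
    swap
    · have : (Finset.univ.filter fun σ : ι → Bool => ∃ x, (swapAt σ p, x) ∈ B) = ∅ := by
        refine Finset.filter_eq_empty_iff.2 fun σ _ => ?_
        rintro ⟨x, ⟨h1, h2⟩, -⟩
        refine hpG fun i => ?_
        have h1 := h1 i
        have h2 := h2 i
        simp only [swapAt] at h1 h2
        cases hσ : σ i <;> simp_all
      obtain ⟨C, hC, -⟩ := hcov p
      have hN : 0 ≤ N := (Nat.cast_nonneg _).trans hC
      rw [this, Finset.card_empty, Nat.cast_zero]
      positivity
    obtain ⟨C, hC, hcov⟩ := hcov p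
    let s : T → ℝ := fun x => ∑ i, q x (p i).1 + ∑ i, q x (p i).2
    let D : (ι → Bool) → T → ℝ := fun σ x =>
      ∑ i, bif σ i then -(q x (p i).1 - q x (p i).2) else q x (p i).1 - q x (p i).2
    have hnet := card_filter_exists_le_of_net (E := fun (σ : ι → Bool) x => (swapAt σ p, x) ∈ B)
      (E' := fun σ x => s x / 4 ≤ D σ x) (good := fun x => L < s x)
      (r := fun x g => ∑ i, (|q x (p i).1 - g (p i).1| + |q x (p i).2 - g (p i).2|) ≤ L / 16)
      C (m := 2 ^ Fintype.card ι * Real.exp (-L / (32 * b))) (by positivity) hC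
      (fun x _ => hcov x) ?_ ?_ ?_
    · refine hnet.trans (le_of_eq (by ring))
    · rintro σ x ⟨-, h1, -⟩
      have h1 : L < ∑ i, q x (swapAt σ p i).1 := h1
      have hs : _ = s x := sum_swapAt_add σ p (q x)
      change L < s x
      rw [← hs]
      have : 0 ≤ ∑ i, q x (swapAt σ p i).2 := Finset.sum_nonneg fun i _ => hq0 _ _
      exact lt_of_lt_of_le h1 (le_add_of_nonneg_right this)
    -- A first sum above `L` and a second at most `L / 3` give `s x / 2 ≤ D σ x`. Passing to `y`
    -- changes `s` and `D` by at most `L / 8` each; as `L < s y`, at least `s y / 4` survives.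
    · rintro x y g hx hy hrx hry σ ⟨-, h1, h2⟩
      have h1 : L < ∑ i, q x (swapAt σ p i).1 := h1
      have h2 : 3 * ∑ i, q x (swapAt σ p i).2 ≤ L := h2
      have hs : _ = s x := sum_swapAt_add σ p (q x)
      have hD : _ = D σ x := sum_swapAt_sub σ p (q x)
      have hd := sum_abs_pair_le p hrx hry
      have hDD : |D σ x - D σ y| ≤ _ := abs_signedSum_pair_sub_le σ p (q x) (q y)
      have hss : |s x - s y| ≤ ∑ i, (|q x (p i).1 - q y (p i).1| + |q x (p i).2 - q y (p i).2|) := by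
        have : s x - s y = ∑ i, ((q x (p i).1 - q y (p i).1) + (q x (p i).2 - q y (p i).2)) := by
          simp only [s, Finset.sum_add_distrib, Finset.sum_sub_distrib]; ring
        rw [this]
        exact (Finset.abs_sum_le_sum_abs _ _).trans (Finset.sum_le_sum fun i _ => abs_add_le _ _)
      have hDD' := (abs_le.1 hDD).2
      have hss' := (abs_le.1 hss).1
      change s y / 4 ≤ D σ y
      linarith
    · intro y hy
      -- For values in `[0, b]` the variance proxy is at most `b` times the total. The Hoeffding
      -- exponent is therefore linear in `s y`, and the worst case is `s y = L`.
      have hV : ∑ i, (q y (p i).1 - q y (p i).2) ^ 2 ≤ b * s y := by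
        simp only [s]
        rw [← Finset.sum_add_distrib, Finset.mul_sum]
        refine Finset.sum_le_sum fun i _ => ?_
        have h1 := hq0 y (p i).1
        have h2 := hq0 y (p i).2
        have h3 := hqb y _ (hpG i).1
        have h4 := hqb y _ (hpG i).2
        nlinarith [mul_nonneg h1 h2, mul_nonneg h1 (sub_nonneg.2 h3),
          mul_nonneg h2 (sub_nonneg.2 h4)]
      have hy0 : 0 < s y := hL.trans hy
      refine (card_filter_le_signedSum_le _ (by positivity) (by positivity) hV).trans ?_
      have : -(s y / 4) ^ 2 / (2 * (b * s y)) = -(s y) / (32 * b) := by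
        field_simp; norm_num
      rw [this]
      have hy' : L ≤ s y := hy.le
      gcongr

open Classical in
/-- Uniform lower bound, over a class of functions with controlled sums of squares, for the
deviation of sums over an i.i.d. sample from their expectations. -/
theorem measure_exists_sum_lt_le (P : Measure 𝒵) [IsProbabilityMeasure P] {f : T → 𝒵 → ℝ}
    (hf : Measurable (Function.uncurry f)) (hf2 : ∀ x, MemLp (f x) 2 P) {v L N u : ℝ}
    (hv : ∀ x, ∫ z, f x z ^ 2 ∂P ≤ v) (hu : 0 < u) (hvu : 16 * (Fintype.card ι * v) ≤ u ^ 2)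
    (hL : 0 < L) (hvL : 4 * (Fintype.card ι * v) ≤ L)
    (hcov : ∀ p : ι → 𝒵 × 𝒵, ∃ C : Finset (𝒵 → ℝ), (C.card : ℝ) ≤ N ∧ ∀ x, ∃ g ∈ C,
      ∑ i, (|f x (p i).1 - g (p i).1| + |f x (p i).2 - g (p i).2|) ≤ u / 16) :
    (Measure.pi fun _ : ι => P) {z | ∃ x, ∑ i, f x (z i) ^ 2 ≤ L ∧
        ∑ i, f x (z i) < Fintype.card ι * (∫ z, f x z ∂P) - u} ≤
      2 * ENNReal.ofReal (N * Real.exp (-u ^ 2 / (128 * L))) := by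
  let A : Set ((ι → 𝒵) × T) := {a | ∑ i, f a.2 (a.1 i) ^ 2 ≤ L ∧
        ∑ i, f a.2 (a.1 i) < Fintype.card ι * (∫ z, f a.2 z ∂P) - u}
  let B : Set ((ι → 𝒵 × 𝒵) × T) := {a | (∑ i, f a.2 (a.1 i).1 ^ 2 ≤ L ∧
    ∑ i, f a.2 (a.1 i).2 ^ 2 ≤ L) ∧ u / 2 ≤ ∑ i, f a.2 (a.1 i).2 - ∑ i, f a.2 (a.1 i).1}
  have hA : {z | ∃ x, ∑ i, f x (z i) ^ 2 ≤ L ∧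
        ∑ i, f x (z i) < Fintype.card ι * (∫ z, f x z ∂P) - u} = Prod.fst '' A := by
    ext z; simp [A]
  have hp1 : ∀ i : ι, Measurable fun a : (ι → 𝒵 × 𝒵) × T => f a.2 (a.1 i).1 := fun i =>
    hf.comp (measurable_snd.prodMk (by fun_prop))
  have hp2 : ∀ i : ι, Measurable fun a : (ι → 𝒵 × 𝒵) × T => f a.2 (a.1 i).2 := fun i =>
    hf.comp (measurable_snd.prodMk (by fun_prop))
  have hB : MeasurableSet B := by
    refine .inter (.inter ?_ ?_) ?_
    · exact measurableSet_le (Finset.measurable_sum _ fun i _ => (hp1 i).pow_const 2)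
        measurable_const
    · exact measurableSet_le (Finset.measurable_sum _ fun i _ => (hp2 i).pow_const 2)
        measurable_const
    · exact measurableSet_le measurable_const ((Finset.measurable_sum _ fun i _ => hp2 i).sub
        (Finset.measurable_sum _ fun i _ => hp1 i))
  rw [hA]
  refine measure_image_fst_le_of_symmetrization P A hB ?_ fun p => ?_
  · rintro z x ⟨hz, hzu⟩
    refine two_inv_le_of_measure_compl_le _ ?_
    -- Two failures of probability at most `1 / 4` for the second sample: a sum of squares of at
    -- least `L`, by Markov, and a deviation of at least `u / 2` below the mean, by Chebyshev.
    have hM := measure_le_sum_le (ι := ι) P (hf2 x).integrable_sq (fun z => sq_nonneg (f x z))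
      (L := L) (r := 1 / 4) hL (hv x) (by linarith)
    have hC := measure_sum_le_sub_le (ι := ι) P (hf2 x) (u := u / 2) (r := 1 / 4)
      (by positivity) (hv x) (by linarith)
    have h2 : ENNReal.ofReal (1 / 4) + ENNReal.ofReal (1 / 4) = 2⁻¹ := by
      rw [← ENNReal.ofReal_add (by norm_num) (by norm_num)]
      norm_num
      rw [one_div, ENNReal.ofReal_inv_of_pos (by norm_num)]; simp
    rw [← h2]
    refine le_trans (measure_mono ?_) ((measure_union_le _ _).trans (add_le_add hM hC))
    intro z' hzB
    by_contra hcon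
    rw [mem_union, not_or] at hcon
    have h3 : ¬ (L ≤ ∑ i, f x (z' i) ^ 2) := hcon.1
    have h4 : ¬ (∑ i, f x (z' i) ≤ Fintype.card ι * (∫ z, f x z ∂P) - u / 2) := hcon.2
    have hzu : ∑ i, f x (z i) < Fintype.card ι * (∫ z, f x z ∂P) - u := hzu
    refine hzB ⟨⟨hz, (not_le.1 h3).le⟩, ?_⟩
    change u / 2 ≤ ∑ i, f x (z' i) - ∑ i, f x (z i)
    linarith [not_le.1 h4]
  · obtain ⟨C, hC, hcov⟩ := hcov p
    let s : T → ℝ := fun x => ∑ i, f x (p i).1 ^ 2 + ∑ i, f x (p i).2 ^ 2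
    let D : (ι → Bool) → T → ℝ := fun σ x =>
      ∑ i, bif σ i then -(f x (p i).1 - f x (p i).2) else f x (p i).1 - f x (p i).2
    have hneg : ∀ σ x, -D σ x = ∑ i, bif σ i then -(f x (p i).2 - f x (p i).1) else
        f x (p i).2 - f x (p i).1 := by
      intro σ x
      rw [← Finset.sum_neg_distrib]
      refine Finset.sum_congr rfl fun i _ => ?_
      cases σ i <;> simp
    have hnet := card_filter_exists_le_of_net (E := fun (σ : ι → Bool) x => (swapAt σ p, x) ∈ B)
      (E' := fun σ x => u / 4 ≤ -D σ x) (good := fun x => s x ≤ 2 * L)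
      (r := fun x g => ∑ i, (|f x (p i).1 - g (p i).1| + |f x (p i).2 - g (p i).2|) ≤ u / 16)
      C (m := 2 ^ Fintype.card ι * Real.exp (-u ^ 2 / (128 * L))) (by positivity) hC
      (fun x _ => hcov x) ?_ ?_ ?_
    · refine hnet.trans (le_of_eq (by ring))
    · rintro σ x ⟨⟨h1, h2⟩, -⟩
      have h1 : ∑ i, f x (swapAt σ p i).1 ^ 2 ≤ L := h1
      have h2 : ∑ i, f x (swapAt σ p i).2 ^ 2 ≤ L := h2
      have hs : _ = s x := sum_swapAt_add σ p (fun z => f x z ^ 2)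
      change s x ≤ 2 * L
      linarith
    -- The two samples differ by at least `u / 2`, and replacing `x` by `y` costs at most `u / 8`.
    · rintro x y g hx hy hrx hry σ ⟨-, h1⟩
      have h1 : u / 2 ≤ ∑ i, f x (swapAt σ p i).2 - ∑ i, f x (swapAt σ p i).1 := h1
      have hD : _ = D σ x := sum_swapAt_sub σ p (f x)
      have hd := sum_abs_pair_le p hrx hry
      have hDD : |D σ x - D σ y| ≤ _ := abs_signedSum_pair_sub_le σ p (f x) (f y)
      have hDD' := (abs_le.1 hDD).1
      change u / 4 ≤ -D σ y
      linarith
    · intro y hy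
      have hV : ∑ i, (f y (p i).2 - f y (p i).1) ^ 2 ≤ 4 * L := by
        have : ∑ i, (f y (p i).2 - f y (p i).1) ^ 2 ≤ 2 * s y := by
          simp only [s]
          rw [← Finset.sum_add_distrib, Finset.mul_sum]
          refine Finset.sum_le_sum fun i _ => ?_
          nlinarith [sq_nonneg (f y (p i).2 + f y (p i).1)]
        have hy : s y ≤ 2 * L := hy
        linarith
      simp_rw [hneg]
      refine (card_filter_le_signedSum_le _ (by positivity) (by positivity) hV).trans ?_
      have : -(u / 4) ^ 2 / (2 * (4 * L)) = -u ^ 2 / (128 * L) := by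
        field_simp; norm_num
      rw [this]

end MaximalInequalities

noncomputable section
namespace CondMoment

/-! ### Covering nets and uniform bounds for the kernel numerators and denominators. -/

/-- The empirical measure of a nonempty family of pairs of points. -/
def pairMeasure {ι 𝒵 : Type*} [Fintype ι] [MeasurableSpace 𝒵] (p : ι → 𝒵 × 𝒵) : Measure 𝒵 :=
  (2 * (Fintype.card ι : ℝ≥0∞))⁻¹ • ∑ i, (Measure.dirac (p i).1 + Measure.dirac (p i).2)

/-- Points of `𝒵` need not be measurable, so integration against Dirac measures requires a
measurable integrand. -/
theorem lintegral_pairMeasure {ι 𝒵 : Type*} [Fintype ι] [MeasurableSpace 𝒵] (p : ι → 𝒵 × 𝒵)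
    {f : 𝒵 → ℝ≥0∞} (hf : Measurable f) :
    ∫⁻ z, f z ∂(pairMeasure p) =
      (2 * (Fintype.card ι : ℝ≥0∞))⁻¹ * ∑ i, (f (p i).1 + f (p i).2) := by
  simp only [pairMeasure, lintegral_smul_measure, lintegral_finsetSum_measure,
    lintegral_add_measure, lintegral_dirac' _ hf, smul_eq_mul]

theorem isProbabilityMeasure_pairMeasure {ι 𝒵 : Type*} [Fintype ι] [Nonempty ι]
    [MeasurableSpace 𝒵] (p : ι → 𝒵 × 𝒵) : IsProbabilityMeasure (pairMeasure p) := by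
  refine ⟨?_⟩
  rw [← lintegral_one, lintegral_pairMeasure p measurable_const]
  have : ∑ _i : ι, ((1 : ℝ≥0∞) + 1) = 2 * Fintype.card ι := by
    rw [Finset.sum_const, Finset.card_univ, nsmul_eq_mul, one_add_one_eq_two, mul_comm]
  rw [this]
  exact ENNReal.inv_mul_cancel (by simp) (ENNReal.mul_ne_top (by simp) (by simp))

/-- A polynomial covering condition gives nets for the `ℓ₁` distance on pairs of samples. -/
theorem PolyCovering.exists_net {𝒵 : Type*} [MeasurableSpace 𝒵] {F : Set (𝒵 → ℝ)} {A V : ℝ}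
    (h : PolyCovering F A V) {ι : Type*} [Fintype ι] [Nonempty ι] (p : ι → 𝒵 × 𝒵)
    {ε : ℝ} (hA : 0 ≤ A) (hε : 0 < ε) (hε1 : ε < 1) :
    ∃ C : Finset (𝒵 → ℝ), (C.card : ℝ) ≤ A * ε ^ (-V) ∧ ∀ f ∈ F, Measurable f → ∃ g ∈ C,
      ∑ i, (|f (p i).1 - g (p i).1| + |f (p i).2 - g (p i).2|) ≤ 2 * Fintype.card ι * ε := by
  classical
  set Q := pairMeasure p
  have hcov := h Q (isProbabilityMeasure_pairMeasure p) ε hε hε1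
  have hfin : coveringNumber ε F Q ≠ ⊤ := by
    intro htop
    rw [htop] at hcov
    simp at hcov
  obtain ⟨n, hn⟩ := ENat.ne_top_iff_exists.1 hfin
  have hlt : coveringNumber ε F Q < ((n + 1 : ℕ) : ℕ∞) := by
    rw [← hn]; exact_mod_cast Nat.lt_succ_self n
  unfold coveringNumber at hlt
  simp only [iInf_lt_iff] at hlt
  obtain ⟨G, ⟨hGi, hGF⟩, hGn⟩ := hlt
  have hGn' : G.card ≤ n := Nat.lt_succ_iff.1 (by exact_mod_cast hGn)
  have hnA : (n : ℝ) ≤ A * ε ^ (-V) := by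
    rw [← hn] at hcov
    have hcov' : (n : ℝ≥0∞) ≤ ENNReal.ofReal (A * ε ^ (-V)) := by simpa using hcov
    rw [← ENNReal.ofReal_natCast, ENNReal.ofReal_le_ofReal_iff (by positivity)] at hcov'
    exact hcov'
  -- Covering functions are only a.e. measurable for `Q`. Measurable representatives make the
  -- `L₁(Q)` distance an actual average over the sample points.
  let ψ : (𝒵 → ℝ) → 𝒵 → ℝ := fun g => if hg : Integrable g Q then hg.1.mk g else g
  refine ⟨G.image ψ, le_trans ?_ hnA, fun f hf hfm => ?_⟩
  · exact_mod_cast Finset.card_image_le.trans hGn'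
  obtain ⟨g, hg, hfg⟩ := hGF f hf
  refine ⟨ψ g, Finset.mem_image_of_mem _ hg, ?_⟩
  have hψ : ψ g = (hGi g hg).1.mk g := by simp only [ψ, dif_pos (hGi g hg)]
  have hψm : Measurable (ψ g) := by
    rw [hψ]; exact (hGi g hg).1.stronglyMeasurable_mk.measurable
  have hψe : g =ᵐ[Q] ψ g := by rw [hψ]; exact (hGi g hg).1.ae_eq_mk
  have h1 : eLpNorm (f - ψ g) 1 Q ≤ ENNReal.ofReal ε := by
    rwa [← eLpNorm_congr_ae (hψe.mono fun z hz => by simp [hz] : f - g =ᵐ[Q] f - ψ g)]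
  rw [eLpNorm_one_eq_lintegral_enorm, lintegral_pairMeasure p (hfm.sub hψm).enorm] at h1
  have h2 : ∑ i, (‖(f - ψ g) (p i).1‖ₑ + ‖(f - ψ g) (p i).2‖ₑ) =
      ENNReal.ofReal (∑ i, (|f (p i).1 - ψ g (p i).1| + |f (p i).2 - ψ g (p i).2|)) := by
    rw [ENNReal.ofReal_sum_of_nonneg fun i _ => by positivity]
    refine Finset.sum_congr rfl fun i _ => ?_
    rw [ENNReal.ofReal_add (abs_nonneg _) (abs_nonneg _)]
    simp [Real.enorm_eq_ofReal_abs]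
  rw [h2, mul_comm, ← div_eq_mul_inv,
    ENNReal.div_le_iff (by simp) (ENNReal.mul_ne_top (by simp) (by simp))] at h1
  have h3 : ENNReal.ofReal ε * (2 * Fintype.card ι) =
      ENNReal.ofReal (2 * Fintype.card ι * ε) := by
    rw [ENNReal.ofReal_mul (by positivity), ENNReal.ofReal_mul (by positivity)]
    simp [mul_comm]
  rw [h3, ENNReal.ofReal_le_ofReal_iff (by positivity)] at h1
  exact h1

variable {dX dY d : ℕ} {𝒲 : Type*} [MeasurableSpace 𝒲]

theorem measurable_moment {m : 𝒲 → Vec d → Vec dY} {θ : Vec d} (hm : Measurable fun w => m w θ)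
    (j : Fin dY) : Measurable fun w => m w θ j :=
  (EuclideanSpace.proj (𝕜 := ℝ) j).continuous.measurable.comp hm

theorem measurable_dilate {k : Vec dX → ℝ} (hk : Measurable k) (h : ℝ) :
    Measurable fun p : Vec dX × Vec dX => dilate k p.1 h p.2 :=
  hk.comp (Measurable.const_smul (measurable_snd.sub measurable_fst) h⁻¹)

/-- A kernel that is bounded below near the origin forces the moment function to be bounded. -/
theorem ae_abs_moment_le {P : Measure (Vec dX × 𝒲)} {m : 𝒲 → Vec d → Vec dY} {Θ : Set (Vec d)}
    {k : Vec dX → ℝ} {Ybar κ : ℝ} (hκ : 0 < κ) (hk : ∀ᶠ t in 𝓝 (0 : Vec dX), κ ≤ k t)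
    (hb : BoundedCondition P m Θ (kernelClass k) Ybar) {θ : Vec d} (hθ : θ ∈ Θ) (j : Fin dY) :
    ∀ᵐ z ∂P, |m z.2 θ j| ≤ Ybar / κ := by
  -- For a large bandwidth the rescaled point is near the origin, where the kernel is at least `κ`;
  -- countably many bandwidths suffice.
  have h1 : ∀ᵐ z ∂P, ∀ N : ℕ, |m z.2 θ j * dilate k 0 (N + 1) z.1| ≤ Ybar :=
    ae_all_iff.2 fun N => hb θ hθ _ ⟨0, N + 1, by positivity, rfl⟩ j
  filter_upwards [h1] with z hz
  have hlim : Tendsto (fun N : ℕ => ((N : ℝ) + 1)⁻¹ • (z.1 - 0)) atTop (𝓝 0) := by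
    have h2 : Tendsto (fun N : ℕ => ((N : ℝ) + 1)⁻¹) atTop (𝓝 0) := by
      simpa [one_div] using tendsto_one_div_add_atTop_nhds_zero_nat (𝕜 := ℝ)
    simpa using h2.smul_const (z.1 - 0)
  obtain ⟨N, hN⟩ := (hlim.eventually hk).exists
  rw [le_div_iff₀ hκ]
  refine le_trans ?_ (hz N)
  rw [abs_mul]
  gcongr
  exact hN.trans (le_abs_self _)

theorem integral_dilate_volume (k : Vec dX → ℝ) (x : Vec dX) {h : ℝ} (hh : 0 < h) :
    ∫ t, dilate k x h t = h ^ dX * ∫ t, k t := by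
  have h1 := integral_sub_right_eq_self (μ := (volume : Measure (Vec dX)))
    (fun t => k (h⁻¹ • t)) x
  have h2 := Measure.integral_comp_inv_smul (volume : Measure (Vec dX)) k h
  simp only [dilate]
  rw [h1, h2, finrank_euclideanSpace_fin, abs_of_pos (by positivity), smul_eq_mul]

theorem integrable_dilate_volume {k : Vec dX → ℝ} (hk : Integrable k) (x : Vec dX) {h : ℝ}
    (hh : 0 < h) : Integrable (dilate k x h) :=
  (hk.comp_smul (inv_ne_zero hh.ne')).comp_sub_right x

/-- A law with bounded density is dominated by a multiple of Lebesgue measure. -/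
theorem exists_le_smul_volume {ν : Measure (Vec dX)} (hν : ∃ f : Vec dX → ℝ, Measurable f ∧
    (∃ fbar : ℝ, ∀ x, f x ≤ fbar) ∧ ν = volume.withDensity fun x => ENNReal.ofReal (f x)) :
    ∃ fbar : ℝ, 0 < fbar ∧ ν ≤ ENNReal.ofReal fbar • volume := by
  obtain ⟨f, -, ⟨fbar, hf⟩, rfl⟩ := hν
  refine ⟨max fbar 1, by positivity, ?_⟩
  rw [← withDensity_const]
  exact withDensity_mono (.of_forall fun x =>
    ENNReal.ofReal_le_ofReal ((hf x).trans (le_max_left _ _)))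

theorem integral_dilate_le {ν : Measure (Vec dX)} {fbar : ℝ} (hf : 0 < fbar)
    (hν : ν ≤ ENNReal.ofReal fbar • volume) {k : Vec dX → ℝ} (hk : Integrable k)
    (hk0 : ∀ t, 0 ≤ k t) (hk1 : ∫ t, k t = 1) (x : Vec dX) {h : ℝ} (hh : 0 < h) :
    ∫ t, dilate k x h t ∂ν ≤ fbar * h ^ dX := by
  have h1 := integral_mono_measure hν (f := dilate k x h) (.of_forall fun t => hk0 _)
    ((integrable_dilate_volume hk x hh).smul_measure (by simp))
  rwa [integral_smul_measure, integral_dilate_volume k x hh, hk1,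
    ENNReal.toReal_ofReal hf.le, mul_one, smul_eq_mul] at h1

theorem integral_comp_fst (P : Measure (Vec dX × 𝒲)) {g : Vec dX → ℝ} (hg : Measurable g) :
    ∫ z, g z.1 ∂P = ∫ x, g x ∂(lawX P) :=
  (integral_map measurable_fst.aemeasurable hg.aestronglyMeasurable).symm

/-- Uniform lower deviations of the kernel sums `∑ m_j(W_i, θ) k((X_i - x) / h)`, for all `x`. -/
theorem measure_exists_kernel_sum_lt_le (P : Measure (Vec dX × 𝒲)) [IsProbabilityMeasure P]
    {m : 𝒲 → Vec d → Vec dY} {Θ : Set (Vec d)} {θ : Vec d} (hθ : θ ∈ Θ)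
    (hm : Measurable fun w => m w θ) (j : Fin dY) {k : Vec dX → ℝ} (hk : Measurable k)
    (hk0 : ∀ t, 0 ≤ k t) {kbar b₀ fbar h : ℝ} (hkb : ∀ t, k t ≤ kbar) (hkbar : 0 < kbar)
    (hb₀ : 0 < b₀) (hb : ∀ᵐ z ∂P, |m z.2 θ j| ≤ b₀) (hh : 0 < h)
    (hf : ∀ x, ∫ t, dilate k x h t ∂(lawX P) ≤ fbar * h ^ dX) {Ybar A V : ℝ} (hA : 0 < A)
    (hV : 0 < V) (hc1 : PolyCovering (momentClass m Θ (kernelClass k) Ybar j) A V)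
    (hc2 : PolyCovering ((fun f z => f z ^ 2) '' momentClass m Θ (kernelClass k) Ybar j) A V)
    {K C : ℝ} (hK : 32 ≤ K) (hK1 : 6 * (b₀ ^ 2 * kbar * fbar) ≤ K)
    (hK2 : 32 * (b₀ * kbar) ^ 2 * (V + 1) ≤ K) (hC : 32 ≤ C)
    (hC1 : 16 * (b₀ ^ 2 * kbar * fbar) ≤ C ^ 2) (hC2 : 128 * K * (V + 1) ≤ C ^ 2) {n : ℕ}
    (hn : 1 ≤ Real.log n) (hnh : Real.log n ≤ n * h ^ dX) (hKh : K * h ^ dX < 32)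
    (hCh : C * √(h ^ dX * Real.log n / n) < 32) :
    (Measure.pi fun _ : Fin n => P) {z | ∃ x, ∑ i, m (z i).2 θ j * dilate k x h (z i).1 <
        n * (∫ z, m z.2 θ j * dilate k x h z.1 ∂P) - n * (C * √(h ^ dX * Real.log n / n))} ≤
      4 * ENNReal.ofReal (A / n) := by
  have hn0 : 0 < (n : ℝ) := by
    rcases Nat.eq_zero_or_pos n with rfl | h0
    · simp at hn; linarith
    · exact_mod_cast h0
  have : Nonempty (Fin n) := Fin.pos_iff_nonempty.1 (by exact_mod_cast hn0)
  set b1 := (b₀ * kbar) ^ 2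
  set cv := b₀ ^ 2 * kbar * fbar
  have hb1 : 0 < b1 := by positivity
  have hhd : 0 < h ^ dX := by positivity
  set δ := √(h ^ dX * Real.log n / n)
  have hδ2 : δ ^ 2 = h ^ dX * Real.log n / n := Real.sq_sqrt (by positivity)
  have hinv : 1 / (n : ℝ) ≤ h ^ dX := by
    rw [div_le_iff₀ hn0]; linarith
  have hδn : 1 / (n : ℝ) ≤ δ := by
    refine Real.le_sqrt_of_sq_le ?_
    rw [one_div, inv_pow, sq, mul_inv, ← div_eq_mul_inv]
    gcongr
    rw [← one_div]
    calc 1 / (n : ℝ) ≤ h ^ dX * 1 := by rwa [mul_one]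
      _ ≤ _ := by gcongr
  have hδ0 : 0 < δ := lt_of_lt_of_le (by positivity) hδn
  let f : Vec dX → Vec dX × 𝒲 → ℝ := fun x z => m z.2 θ j * dilate k x h z.1
  have hfm : Measurable (Function.uncurry f) :=
    ((measurable_moment hm j).comp (measurable_snd.comp measurable_snd)).mul
      ((measurable_dilate hk h).comp (measurable_fst.prodMk (measurable_fst.comp measurable_snd)))
  have hfx : ∀ x, Measurable (f x) := fun x => hfm.of_uncurry_left
  have hd0 : ∀ x t, 0 ≤ dilate k x h t := fun x t => hk0 _
  have hdb : ∀ x t, dilate k x h t ≤ kbar := fun x t => hkb _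
  have hfb : ∀ x z, |m z.2 θ j| ≤ b₀ → |f x z| ≤ b₀ * kbar := by
    intro x z hz
    simp only [f, abs_mul, abs_of_nonneg (hd0 x z.1)]
    exact mul_le_mul hz (hdb _ _) (hd0 _ _) hb₀.le
  have hfL : ∀ x, MemLp (f x) 2 P := fun x =>
    MemLp.of_bound (hfx x).aestronglyMeasurable (b₀ * kbar) (hb.mono fun z hz => hfb x z hz)
  -- One factor of the squared kernel is bounded by `kbar`; integrating the other gives order `h ^
  -- dX` through the density bound.
  have hcv : ∀ x, ∫ z, f x z ^ 2 ∂P ≤ cv * h ^ dX := by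
    intro x
    have hdx : Measurable (dilate k x h) := (measurable_dilate hk h).comp measurable_prodMk_left
    have hdi : Integrable (fun z : Vec dX × 𝒲 => dilate k x h z.1) P :=
      Integrable.of_bound (hdx.comp measurable_fst).aestronglyMeasurable kbar
        (.of_forall fun z => by rw [Real.norm_of_nonneg (hd0 _ _)]; exact hdb _ _)
    calc ∫ z, f x z ^ 2 ∂P ≤ ∫ z, b₀ ^ 2 * kbar * dilate k x h z.1 ∂P := by
          refine integral_mono_ae (hfL x).integrable_sq (hdi.const_mul _) (hb.mono fun z hz => ?_)
          have h2 : m z.2 θ j ^ 2 ≤ b₀ ^ 2 := sq_le_sq' (abs_le.1 hz).1 (abs_le.1 hz).2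
          have h3 := hd0 x z.1
          calc f x z ^ 2 = m z.2 θ j ^ 2 * (dilate k x h z.1 * dilate k x h z.1) := by
                simp only [f]; ring
            _ ≤ b₀ ^ 2 * (kbar * dilate k x h z.1) := by gcongr; exact hdb _ _
            _ = _ := by ring
      _ = b₀ ^ 2 * kbar * ∫ t, dilate k x h t ∂(lawX P) := by
          rw [integral_const_mul, integral_comp_fst P hdx]
      _ ≤ b₀ ^ 2 * kbar * (fbar * h ^ dX) := by gcongr; exact hf x
      _ = cv * h ^ dX := by ring
  have hmem : ∀ x, f x ∈ momentClass m Θ (kernelClass k) Ybar j := by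
    intro x
    have h1 : (1 : ℝ) ≤ max Ybar 1 := le_max_right _ _
    refine ⟨θ, hθ, dilate k x h, ⟨x, h, hh, rfl⟩, 1, ⟨by linarith, h1⟩, 0,
      ⟨by linarith, by linarith⟩, ?_⟩
    funext z; simp [f]
  -- Both net radii used below are at least `1 / n`, so the nets have at most `A * n ^ V` elements.
  -- An exponent of `(V + 1) * log n` then leaves a bound `A / n`.
  have hpow : ∀ ε : ℝ, 1 / (n : ℝ) ≤ ε → A * ε ^ (-V) ≤ A * (n : ℝ) ^ V := by
    intro ε hε
    gcongr
    calc ε ^ (-V) ≤ (1 / (n : ℝ)) ^ (-V) :=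
          Real.rpow_le_rpow_of_nonpos (by positivity) hε (by linarith)
      _ = (n : ℝ) ^ V := by rw [one_div, Real.rpow_neg (by positivity), Real.inv_rpow hn0.le, inv_inv]
  have hexp : ∀ y : ℝ, (V + 1) * Real.log n ≤ y →
      A * (n : ℝ) ^ V * Real.exp (-y) ≤ A / n := by
    intro y hy
    have : Real.exp (-y) ≤ ((n : ℝ) ^ V * n)⁻¹ := by
      rw [Real.rpow_def_of_pos hn0, ← Real.exp_log hn0, ← Real.exp_add, ← Real.exp_neg,
        Real.exp_log hn0]
      gcongr
      linarith
    calc A * (n : ℝ) ^ V * Real.exp (-y) ≤ A * (n : ℝ) ^ V * ((n : ℝ) ^ V * n)⁻¹ := by gcongr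
      _ = A / n := by
        have : (n : ℝ) ^ V ≠ 0 := (Real.rpow_pos_of_pos hn0 V).ne'
        field_simp
  -- `L` is the level for the sums of squares: the first maximal inequality shows that exceeding it
  -- is unlikely, the second bounds deviations below it.
  set L := n * (K * h ^ dX) with hL
  have hL0 : 0 < L := by positivity
  have hG : MeasurableSet {z : Vec dX × 𝒲 | |m z.2 θ j| ≤ b₀} :=
    measurableSet_le ((measurable_moment hm j).comp measurable_snd).abs measurable_const
  have hq := measure_exists_lt_sum_le (ι := Fin n) P (q := fun x z => f x z ^ 2)
    (hfm.pow_const 2) (fun x z => sq_nonneg _) hG hb hb1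
    (fun x z hz => by
      rw [← sq_abs]
      exact pow_le_pow_left₀ (abs_nonneg _) (hfb x z hz) 2) hcv hL0
    (N := A * (n : ℝ) ^ V) (by
      rw [Fintype.card_fin, hL]
      have : 6 * (n * (cv * h ^ dX)) = n * (6 * cv * h ^ dX) := by ring
      rw [this]
      gcongr) (fun p => by
      obtain ⟨D, hD, hDf⟩ := hc2.exists_net p hA.le (ε := K * h ^ dX / 32) (by positivity)
        (by linarith)
      refine ⟨D, hD.trans (hpow _ ?_), fun x => ?_⟩
      · refine hinv.trans ?_
        rw [le_div_iff₀ (by norm_num), mul_comm]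
        gcongr
      · obtain ⟨g, hg, hgx⟩ := hDf _ ⟨f x, hmem x, rfl⟩ ((hfx x).pow_const 2)
        refine ⟨g, hg, hgx.trans (le_of_eq ?_)⟩
        rw [Fintype.card_fin, hL]; ring)
  have hu : 0 < n * (C * δ) := by positivity
  have hu2 : (n * (C * δ)) ^ 2 = C ^ 2 * (n * h ^ dX * Real.log n) := by
    rw [mul_pow, mul_pow, hδ2]; field_simp
  have hl := measure_exists_sum_lt_le (ι := Fin n) P hfm hfL hcv hu (by
      rw [Fintype.card_fin, hu2]
      calc 16 * (n * (cv * h ^ dX)) = 16 * cv * (n * h ^ dX * 1) := by ring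
        _ ≤ C ^ 2 * (n * h ^ dX * Real.log n) := by gcongr) hL0 (by
      rw [Fintype.card_fin, hL]
      have h1 : 4 * (n * (cv * h ^ dX)) = n * (4 * cv * h ^ dX) := by ring
      rw [h1]
      gcongr
      linarith) (N := A * (n : ℝ) ^ V) (fun p => by
      obtain ⟨D, hD, hDf⟩ := hc1.exists_net p hA.le (ε := C * δ / 32) (by positivity)
        (by linarith)
      refine ⟨D, hD.trans (hpow _ ?_), fun x => ?_⟩
      · refine hδn.trans ?_
        rw [le_div_iff₀ (by norm_num), mul_comm]
        gcongr
      · obtain ⟨g, hg, hgx⟩ := hDf _ (hmem x) (hfx x)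
        refine ⟨g, hg, hgx.trans (le_of_eq ?_)⟩
        rw [Fintype.card_fin]; ring)
  have hgood : ∀ᵐ z ∂(Measure.pi fun _ : Fin n => P), ∀ i, |m (z i).2 θ j| ≤ b₀ := by
    rw [ae_all_iff]
    exact fun i => (measurePreserving_eval (fun _ : Fin n => P) i).quasiMeasurePreserving.ae hb
  have e1 : A * (n : ℝ) ^ V * Real.exp (-L / (32 * b1)) ≤ A / n := by
    rw [neg_div]
    refine hexp _ ?_
    rw [le_div_iff₀ (by positivity), hL]
    calc (V + 1) * Real.log n * (32 * b1) = 32 * b1 * (V + 1) * Real.log n := by ring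
      _ ≤ K * (n * h ^ dX) := by gcongr
      _ = _ := by ring
  have e2 : A * (n : ℝ) ^ V * Real.exp (-(n * (C * δ)) ^ 2 / (128 * L)) ≤ A / n := by
    rw [neg_div]
    refine hexp _ ?_
    rw [le_div_iff₀ (by positivity), hL, hu2]
    calc (V + 1) * Real.log n * (128 * (n * (K * h ^ dX)))
        = 128 * K * (V + 1) * (n * h ^ dX * Real.log n) := by ring
      _ ≤ C ^ 2 * (n * h ^ dX * Real.log n) := by gcongr
  have hfin : ∀ {y : ℝ}, y ≤ A / n →
      2 * ENNReal.ofReal y ≤ 2 * ENNReal.ofReal (A / n) := fun hy => by gcongr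
  calc _ ≤ (Measure.pi fun _ : Fin n => P) ({z | ∃ x, (∀ i, z i ∈ {z : Vec dX × 𝒲 |
            |m z.2 θ j| ≤ b₀}) ∧ L < ∑ i, f x (z i) ^ 2} ∪
          {z | ∃ x, ∑ i, f x (z i) ^ 2 ≤ L ∧
            ∑ i, f x (z i) < Fintype.card (Fin n) * (∫ z, f x z ∂P) - n * (C * δ)}) := by
        refine measure_mono_ae ?_
        filter_upwards [hgood] with z hz
        rintro ⟨x, hx⟩
        by_cases hxL : ∑ i, f x (z i) ^ 2 ≤ L
        · exact .inr ⟨x, hxL, by rw [Fintype.card_fin]; exact hx⟩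
        · exact .inl ⟨x, hz, not_le.1 hxL⟩
    _ ≤ 2 * ENNReal.ofReal (A / n) + 2 * ENNReal.ofReal (A / n) :=
        (measure_union_le _ _).trans (add_le_add (hq.trans (hfin e1)) (hl.trans (hfin e2)))
    _ = 4 * ENNReal.ofReal (A / n) := by ring

/-- A Chernoff bound for the lower tail of the number of sample points in a set. -/
theorem measure_sum_indicator_le {ι 𝒵 : Type*} [Fintype ι] [MeasurableSpace 𝒵] (P : Measure 𝒵)
    [IsProbabilityMeasure P] {B : Set 𝒵} (hB : MeasurableSet B) {p : ℝ} (hp : p ≤ P.real B) :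
    (Measure.pi fun _ : ι => P) {z | ∑ i, B.indicator (1 : 𝒵 → ℝ) (z i) ≤ Fintype.card ι * p / 4} ≤
      ENNReal.ofReal (Real.exp (-(Fintype.card ι * p / 4))) := by
  set n : ℝ := (Fintype.card ι : ℝ)
  -- Exponential Markov with parameter `-1`: since `exp (-1) ≤ 1 / 2`, the mean of `g` is at most `1
  -- - p / 2 ≤ exp (-(p / 2))`.
  let g : 𝒵 → ℝ := fun z => Real.exp (-B.indicator (1 : 𝒵 → ℝ) z)
  have hg : ∀ z, g z = 1 - (1 - Real.exp (-1)) * B.indicator (1 : 𝒵 → ℝ) z := by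
    intro z
    by_cases hz : z ∈ B <;> simp [g, hz]
  have hBi : Integrable (B.indicator (1 : 𝒵 → ℝ)) P :=
    (integrable_indicator_iff hB).2 (integrable_const (1 : ℝ)).integrableOn
  have hgi : Integrable g P := by
    rw [funext hg]
    exact (integrable_const 1).sub (hBi.const_mul _)
  have he : Real.exp (-1) ≤ 1 / 2 := by
    rw [Real.exp_neg, one_div]
    have := Real.add_one_le_exp 1
    gcongr
    linarith
  have hg1 : ∫ z, g z ∂P ≤ Real.exp (-(p / 2)) := by
    rw [funext hg, integral_sub (integrable_const 1) (hBi.const_mul _), integral_const_mul,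
      integral_indicator_one hB]
    have h0 : 0 ≤ P.real B := measureReal_nonneg
    have h1 : -(p / 2) + 1 ≤ Real.exp (-(p / 2)) := Real.add_one_le_exp _
    simp only [integral_const, probReal_univ, one_smul]
    nlinarith
  have hint : Integrable (fun z : ι → 𝒵 => ∏ i, g (z i)) (Measure.pi fun _ : ι => P) :=
    Integrable.fintype_prod fun _ => hgi
  have hpow : ∫ z : ι → 𝒵, ∏ i, g (z i) ∂(Measure.pi fun _ : ι => P) ≤ Real.exp (-(n * p / 2)) := by
    rw [integral_fintype_prod_eq_prod (μ := fun _ : ι => P) fun _ => g, Finset.prod_const,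
      Finset.card_univ]
    calc (∫ z, g z ∂P) ^ Fintype.card ι ≤ Real.exp (-(p / 2)) ^ Fintype.card ι :=
          pow_le_pow_left₀ (integral_nonneg fun z => (Real.exp_pos _).le) hg1 _
      _ = _ := by rw [← Real.exp_nat_mul]; congr 1; ring
  have hM := mul_meas_ge_le_integral_of_nonneg
    (.of_forall fun z => Finset.prod_nonneg fun i _ => (Real.exp_pos _).le) hint
    (Real.exp (-(n * p / 4)))
  have hset : {z : ι → 𝒵 | ∑ i, B.indicator (1 : 𝒵 → ℝ) (z i) ≤ n * p / 4} =
      {z | Real.exp (-(n * p / 4)) ≤ ∏ i, g (z i)} := by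
    ext z
    change (_ : ℝ) ≤ _ ↔ (_ : ℝ) ≤ _
    simp only [g]
    rw [← Real.exp_sum, Real.exp_le_exp, Finset.sum_neg_distrib, neg_le_neg_iff]
  rw [hset, ← ENNReal.ofReal_toReal (measure_ne_top _ _)]
  refine ENNReal.ofReal_le_ofReal ?_
  have h2 := hM.trans hpow
  have h3 : Real.exp (-(n * p / 2)) = Real.exp (-(n * p / 4)) * Real.exp (-(n * p / 4)) := by
    rw [← Real.exp_add]; congr 1; ring
  rw [h3] at h2
  exact le_of_mul_le_mul_left h2 (Real.exp_pos _)

/-- If all closed balls of radius `r` about points of `s` have probability at least `p`, then `s` is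
covered by at most `1 / p` closed balls of radius `2 r`. -/
theorem exists_finset_cover_of_measure_closedBall_ge {E : Type*} [PseudoMetricSpace E]
    [MeasurableSpace E] [OpensMeasurableSpace E] (ν : Measure E) [IsProbabilityMeasure ν]
    {s : Set E} {r p : ℝ} (hp : 0 < p) (hs : ∀ x ∈ s, p ≤ ν.real (Metric.closedBall x r)) :
    ∃ F : Finset E, (F.card : ℝ) ≤ 1 / p ∧ (∀ y ∈ F, y ∈ s) ∧
      ∀ x ∈ s, ∃ y ∈ F, dist x y ≤ 2 * r := by
  classical
  -- A `2 r`-separated subset of `s` has disjoint `r`-balls of mass at least `p`, hence at most `1 /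
  -- p` points; one of maximal cardinality covers `s`.
  let Sep : Finset E → Prop := fun F => (∀ y ∈ F, y ∈ s) ∧
    ∀ x ∈ F, ∀ y ∈ F, x ≠ y → 2 * r < dist x y
  have hcard : ∀ F, Sep F → (F.card : ℝ) ≤ 1 / p := by
    rintro F ⟨hF, hsep⟩
    rw [le_div_iff₀ hp]
    have hdisj : (F : Set E).PairwiseDisjoint fun x => Metric.closedBall x r := by
      intro x hx y hy hxy
      refine Metric.closedBall_disjoint_closedBall ?_
      linarith [hsep x hx y hy hxy]
    calc (F.card : ℝ) * p = ∑ _x ∈ F, p := by simp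
      _ ≤ ∑ x ∈ F, ν.real (Metric.closedBall x r) :=
        Finset.sum_le_sum fun x hx => hs x (hF x hx)
      _ = ν.real (⋃ x ∈ F, Metric.closedBall x r) :=
        (measureReal_biUnion_finset hdisj fun x _ => Metric.isClosed_closedBall.measurableSet).symm
      _ ≤ 1 := measureReal_le_one
  have hbdd : BddAbove {n : ℕ | ∃ F, Sep F ∧ F.card = n} := by
    refine ⟨⌊1 / p⌋₊, ?_⟩
    rintro _ ⟨F, hF, rfl⟩
    exact Nat.le_floor (hcard F hF)
  obtain ⟨F, hF, hFc⟩ := Nat.sSup_mem (s := {n : ℕ | ∃ F, Sep F ∧ F.card = n})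
    ⟨0, ∅, by simp [Sep], rfl⟩ hbdd
  refine ⟨F, hcard F hF, hF.1, fun x hx => ?_⟩
  by_contra! hcon
  have hxF : x ∉ F := by
    intro h
    have h1 := hcon x h
    have h2 : ν.real (Metric.closedBall x r) = 0 := by
      rw [Metric.closedBall_eq_empty.2 (by rw [dist_self] at h1; linarith)]
      simp
    linarith [hs x hx]
  have hsep : Sep (insert x F) := by
    refine ⟨fun y hy => ?_, fun y hy z hz hyz => ?_⟩
    · rcases Finset.mem_insert.1 hy with rfl | hy
      exacts [hx, hF.1 y hy]
    · rcases Finset.mem_insert.1 hy with hyx | hy <;> rcases Finset.mem_insert.1 hz with hzx | hz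
      · exact absurd (hyx.trans hzx.symm) hyz
      · rw [hyx]; exact hcon z hz
      · rw [hzx, dist_comm]; exact hcon y hy
      · exact hF.2 y hy z hz hyz
  have := le_csSup hbdd ⟨_, hsep, rfl⟩
  rw [Finset.card_insert_of_notMem hxF, hFc] at this
  omega

/-- Uniform lower bound for the kernel density sums over the support of `X`. -/
theorem measure_exists_kernel_density_lt_le (P : Measure (Vec dX × 𝒲)) [IsProbabilityMeasure P]
    {k : Vec dX → ℝ} (hk0 : ∀ t, 0 ≤ k t) {κ ρ η ε₀ h a : ℝ} (hκ : 0 < κ) (hρ : 0 < ρ)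
    (hkρ : ∀ t, ‖t‖ ≤ ρ → κ ≤ k t) (hη : 0 < η)
    (hsupp : ∀ ε : ℝ, 0 < ε → ε ≤ ε₀ → ∀ x ∈ suppX P,
      η ≤ (lawX P).real (Metric.closedBall x ε) / ε ^ dX)
    (hh : 0 < h) (hhε : ρ * h / 2 ≤ ε₀) (ha : 1 ≤ a) (haη : 8 ≤ η * (ρ / 2) ^ dX * a) {n : ℕ}
    (hn : 1 ≤ Real.log n) (hnh : a * Real.log n ≤ n * h ^ dX) :
    (Measure.pi fun _ : Fin n => P) {z | ∃ x ∈ suppX P, ∑ i, dilate k x h (z i).1 <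
        n * (κ * (η * (ρ / 2) ^ dX / 4) * h ^ dX)} ≤
      ENNReal.ofReal (1 / (η * (ρ / 4) ^ dX) / n) := by
  have hn0 : 0 < (n : ℝ) := by
    rcases Nat.eq_zero_or_pos n with rfl | h0
    · simp at hn; linarith
    · exact_mod_cast h0
  have : IsProbabilityMeasure (lawX P) := Measure.isProbabilityMeasure_map measurable_fst.aemeasurable
  have hball : ∀ ε : ℝ, 0 < ε → ε ≤ ε₀ → ∀ x ∈ suppX P,
      η * ε ^ dX ≤ (lawX P).real (Metric.closedBall x ε) := fun ε h1 h2 x hx =>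
    (le_div_iff₀ (by positivity)).1 (hsupp ε h1 h2 x hx)
  have hρh : 0 < ρ * h := by positivity
  -- Centers lie within `ρ * h / 2` of every support point, so sample points within `ρ * h / 2` of
  -- the center are within `ρ * h` of `x` and have kernel weight at least `κ`.
  obtain ⟨F, hFc, hFs, hF⟩ := exists_finset_cover_of_measure_closedBall_ge (lawX P)
    (s := suppX P) (r := ρ * h / 4) (p := η * (ρ * h / 4) ^ dX) (by positivity)
    (hball _ (by positivity) (by linarith))
  set p := η * (ρ * h / 2) ^ dX with hp
  have hBm : ∀ y : Vec dX, MeasurableSet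
      (Prod.fst ⁻¹' Metric.closedBall y (ρ * h / 2) : Set (Vec dX × 𝒲)) := fun y =>
    measurable_fst Metric.isClosed_closedBall.measurableSet
  have hsub : {z : Fin n → Vec dX × 𝒲 | ∃ x ∈ suppX P, ∑ i, dilate k x h (z i).1 <
        n * (κ * (η * (ρ / 2) ^ dX / 4) * h ^ dX)} ⊆
      ⋃ y ∈ F, {z | ∑ i, (Prod.fst ⁻¹' Metric.closedBall y (ρ * h / 2)).indicator
        (1 : Vec dX × 𝒲 → ℝ) (z i) ≤ Fintype.card (Fin n) * p / 4} := by
    rintro z ⟨x, hx, hzx⟩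
    obtain ⟨y, hy, hxy⟩ := hF x hx
    refine mem_iUnion₂.2 ⟨y, hy, ?_⟩
    have h1 : κ * ∑ i, (Prod.fst ⁻¹' Metric.closedBall y (ρ * h / 2)).indicator
        (1 : Vec dX × 𝒲 → ℝ) (z i) ≤ ∑ i, dilate k x h (z i).1 := by
      rw [Finset.mul_sum]
      refine Finset.sum_le_sum fun i _ => ?_
      by_cases hi : z i ∈ (Prod.fst ⁻¹' Metric.closedBall y (ρ * h / 2) : Set (Vec dX × 𝒲))
      · rw [indicator_of_mem hi, Pi.one_apply, mul_one]
        refine hkρ _ ?_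
        rw [norm_smul, norm_inv, Real.norm_of_nonneg hh.le, ← dist_eq_norm,
          inv_mul_le_iff₀ hh]
        have h2 : dist (z i).1 y ≤ ρ * h / 2 := hi
        have h3 := dist_triangle_right (z i).1 x y
        linarith
      · rw [indicator_of_notMem hi, mul_zero]
        exact hk0 _
    have h2 := h1.trans hzx.le
    have h3 : n * (κ * (η * (ρ / 2) ^ dX / 4) * h ^ dX) = κ * (n * p / 4) := by
      rw [hp, show ρ * h / 2 = ρ / 2 * h by ring, mul_pow]; ring
    rw [h3] at h2
    rw [Fintype.card_fin]
    change ∑ i : Fin n, (Prod.fst ⁻¹' Metric.closedBall y (ρ * h / 2)).indicator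
      (1 : Vec dX × 𝒲 → ℝ) (z i) ≤ _
    exact le_of_mul_le_mul_left h2 hκ
  -- The condition on `a` gives exponent `2 * log n`: one factor `1 / n` pays for the number of
  -- centers, of order `n`, and the other remains.
  have hexp : Real.exp (-(n * p / 4)) ≤ (n : ℝ)⁻¹ * (n : ℝ)⁻¹ := by
    have h1 : 2 * Real.log n ≤ n * p / 4 := by
      have h2 : n * p / 4 = η * (ρ / 2) ^ dX / 4 * (n * h ^ dX) := by
        rw [hp, show ρ * h / 2 = ρ / 2 * h by ring, mul_pow]; ring
      rw [h2]
      calc 2 * Real.log n ≤ η * (ρ / 2) ^ dX * a / 4 * Real.log n := by gcongr; linarith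
        _ = η * (ρ / 2) ^ dX / 4 * (a * Real.log n) := by ring
        _ ≤ _ := by gcongr
    calc Real.exp (-(n * p / 4)) ≤ Real.exp (-Real.log n + -Real.log n) := by gcongr; linarith
      _ = _ := by rw [Real.exp_add, Real.exp_neg, Real.exp_log hn0]
  have hcardn : (F.card : ℝ) ≤ 1 / (η * (ρ / 4) ^ dX) * n := by
    refine hFc.trans ?_
    rw [mul_div_right_comm, mul_pow, ← mul_assoc, div_mul_eq_mul_div, one_mul,
      div_le_div_iff₀ (by positivity) (by positivity)]
    have h1 : 1 ≤ n * h ^ dX := by nlinarith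
    calc 1 * (η * (ρ / 4) ^ dX) = η * (ρ / 4) ^ dX * 1 := by ring
      _ ≤ η * (ρ / 4) ^ dX * (n * h ^ dX) := by gcongr
      _ = _ := by ring
  have hreal : ∀ y ∈ F, p ≤ P.real (Prod.fst ⁻¹' Metric.closedBall y (ρ * h / 2)) := by
    intro y hy
    have h1 := hball (ρ * h / 2) (by positivity) hhε y (hFs y hy)
    rwa [lawX, map_measureReal_apply measurable_fst Metric.isClosed_closedBall.measurableSet] at h1
  calc _ ≤ _ := measure_mono hsub
    _ ≤ ∑ y ∈ F, _ := measure_biUnion_finset_le _ _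
    _ ≤ ∑ _y ∈ F, ENNReal.ofReal ((n : ℝ)⁻¹ * (n : ℝ)⁻¹) := by
      refine Finset.sum_le_sum fun y hy => ?_
      refine (measure_sum_indicator_le (ι := Fin n) P (hBm y) (hreal y hy)).trans ?_
      rw [Fintype.card_fin]
      exact ENNReal.ofReal_le_ofReal hexp
    _ = ENNReal.ofReal (F.card * ((n : ℝ)⁻¹ * (n : ℝ)⁻¹)) := by
      rw [Finset.sum_const, nsmul_eq_mul, ENNReal.ofReal_mul (p := (F.card : ℝ)) (by positivity),
        ENNReal.ofReal_natCast]
    _ ≤ _ := by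
      refine ENNReal.ofReal_le_ofReal ?_
      calc (F.card : ℝ) * ((n : ℝ)⁻¹ * (n : ℝ)⁻¹)
          ≤ 1 / (η * (ρ / 4) ^ dX) * n * ((n : ℝ)⁻¹ * (n : ℝ)⁻¹) := by gcongr
        _ = _ := by field_simp

/-! ### Geometry of the identified set near its boundary. -/

/-- Near a boundary point of `s` there is a segment that leaves `s` at unit speed, starting at
another boundary point. -/
theorem exists_segment_leaving {E : Type*} [NormedAddCommGroup E] [NormedSpace ℝ E]
    [ProperSpace E] {s : Set E} {θ₀ : E} (hθ₀ : θ₀ ∈ frontier s) {r : ℝ} (hr : 0 < r)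
    (hs : closure s ∩ Metric.ball θ₀ r ⊆ s) :
    ∃ θb ∈ s ∩ (frontier s ∩ Metric.ball θ₀ r), ∃ D > 0, ∃ g : ℝ → E, ∀ t, 0 ≤ t → t ≤ D →
      g t ∈ Metric.ball θ₀ r ∧ dist (g t) θb ≤ t ∧ ∀ y ∈ s, t ≤ dist (g t) y := by
  have hcl : θ₀ ∈ closure s := hθ₀.1
  have hcompl : θ₀ ∈ closure sᶜ := by
    rw [closure_compl]; exact hθ₀.2
  obtain ⟨θ', hθ's, hθ'⟩ := Metric.mem_closure_iff.1 hcompl (r / 4) (by positivity)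
  -- `θb` is a nearest point to `θ'`. On the segment between them, the point at distance `t` from
  -- `θb` is `D - t` from `θ'`, so the triangle inequality keeps it at least `t` from `s`.
  obtain ⟨θb, hθb, hdist⟩ := isClosed_closure.exists_infDist_eq_dist ⟨θ₀, hcl⟩ θ'
  have hle : dist θ' θb ≤ dist θ' θ₀ := hdist ▸ Metric.infDist_le_dist_of_mem hcl
  rw [dist_comm] at hθ'
  have hbb : dist θb θ₀ < r := by
    have := dist_triangle_left θb θ₀ θ'
    linarith
  have hbs : θb ∈ s := hs ⟨hθb, hbb⟩
  have hD : 0 < dist θ' θb := by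
    rw [dist_pos]; rintro rfl; exact hθ's hbs
  set D := dist θ' θb with hDdef
  have hmain : ∀ t, 0 ≤ t → t ≤ D → AffineMap.lineMap (k := ℝ) θb θ' (t / D) ∈ Metric.ball θ₀ r ∧
      dist (AffineMap.lineMap (k := ℝ) θb θ' (t / D)) θb ≤ t ∧
      ∀ y ∈ s, t ≤ dist (AffineMap.lineMap (k := ℝ) θb θ' (t / D)) y := by
    intro t ht htD
    have h1 : dist (AffineMap.lineMap (k := ℝ) θb θ' (t / D)) θb = t := by
      rw [dist_lineMap_left, Real.norm_of_nonneg (by positivity), dist_comm θb, ← hDdef]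
      field_simp
    have h2 : dist (AffineMap.lineMap (k := ℝ) θb θ' (t / D)) θ' = D - t := by
      have h3 : t / D ≤ 1 := (div_le_one hD).2 htD
      rw [dist_lineMap_right, Real.norm_of_nonneg (by linarith), dist_comm θb, ← hDdef]
      field_simp
    refine ⟨?_, h1.le, fun y hy => ?_⟩
    · have := dist_triangle (AffineMap.lineMap (k := ℝ) θb θ' (t / D)) θ' θ₀
      rw [Metric.mem_ball]
      linarith
    · have h3 : D ≤ dist θ' y := hdist ▸ Metric.infDist_le_dist_of_mem (subset_closure hy)
      have := dist_triangle_left θ' y (AffineMap.lineMap (k := ℝ) θb θ' (t / D))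
      linarith
  refine ⟨θb, ⟨hbs, ⟨hθb, fun hint => ?_⟩, hbb⟩, D, hD, _, hmain⟩
  -- If `θb` were interior, a short piece of the segment would lie in `s` yet be at positive
  -- distance from `s`.
  obtain ⟨e, he, hball⟩ := Metric.mem_nhds_iff.1 (mem_interior_iff_mem_nhds.1 hint)
  set t := min D (e / 2)
  have ht : 0 < t := by positivity
  obtain ⟨-, h1, h2⟩ := hmain t ht.le (min_le_left _ _)
  have h3 := h2 _ (hball (Metric.mem_ball.2 (h1.trans_lt
    ((min_le_right _ _).trans_lt (half_lt_self he)))))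
  rw [dist_self] at h3
  linarith

theorem ae_fst_mem_suppX (P : Measure (Vec dX × 𝒲)) : ∀ᵐ z ∂P, z.1 ∈ suppX P :=
  ae_of_ae_map measurable_fst.aemeasurable (Measure.support_mem_ae (μ := lawX P))

/-- Within the ball, the identified set is closed. -/
theorem LocalSmoothness.mem_of_mem_closure {P : Measure (Vec dX × 𝒲)} {m : 𝒲 → Vec d → Vec dY}
    {Θ : Set (Vec d)} {mbar : Vec d → Vec dX → Vec dY} {α r : ℝ} {θ₀ : Vec d}
    (hmbar : IsCondMean P m Θ mbar) (hr : Metric.ball θ₀ r ⊆ Θ)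
    (hl : LocalSmoothness P mbar (identifiedSet P m Θ) α θ₀ r) :
    closure (identifiedSet P m Θ) ∩ Metric.ball θ₀ r ⊆ identifiedSet P m Θ := by
  rintro θ ⟨hcl, hθ⟩
  -- The inequalities hold at every support point for nearby members of the set and pass to the
  -- limit by continuity in `θ`.
  have hnn : ∀ x ∈ suppX P, ∀ j, 0 ≤ mbar θ x j := by
    intro x hx j
    by_contra! hneg
    have hc : ContinuousAt (fun θ' => mbar θ' x j) θ :=
      (EuclideanSpace.proj (𝕜 := ℝ) j).continuous.continuousAt.comp
        (hl.differentiable θ hθ x hx).continuousAt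
    have hev : ∀ᶠ θ' in 𝓝 θ, mbar θ' x j < 0 ∧ θ' ∈ Metric.ball θ₀ r :=
      (hc.eventually (gt_mem_nhds hneg)).and (Metric.isOpen_ball.mem_nhds hθ)
    obtain ⟨θ', h3, h1, h2⟩ := ((mem_closure_iff_frequently.1 hcl).and_eventually hev).exists
    exact absurd (hl.nonneg_on_support θ' ⟨h3, h2⟩ x hx j) (not_le.2 h1)
  refine ⟨hr hθ, fun j => ?_⟩
  filter_upwards [ae_fst_mem_suppX P, hmbar.ae_eq θ (hr hθ) j] with z hz hze
  rw [← hze]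
  exact hnn _ hz j

/-! ### Conditional means and the smoothing bias of order `h ^ α`. -/

theorem integrable_moment {P : Measure (Vec dX × 𝒲)} [IsProbabilityMeasure P]
    {m : 𝒲 → Vec d → Vec dY} {θ : Vec d} (hm : Measurable fun w => m w θ) {j : Fin dY} {b₀ : ℝ}
    (hb : ∀ᵐ z ∂P, |m z.2 θ j| ≤ b₀) : Integrable (fun z : Vec dX × 𝒲 => m z.2 θ j) P :=
  Integrable.of_bound ((measurable_moment hm j).comp measurable_snd).aestronglyMeasurable b₀ hb

/-- Bounded moment functions have bounded conditional means. -/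
theorem IsCondMean.ae_abs_le {P : Measure (Vec dX × 𝒲)} [IsProbabilityMeasure P]
    {m : 𝒲 → Vec d → Vec dY} {Θ : Set (Vec d)} {mbar : Vec d → Vec dX → Vec dY}
    (hmbar : IsCondMean P m Θ mbar) {θ : Vec d} (hθ : θ ∈ Θ) {j : Fin dY} {b₀ : ℝ}
    (hb : ∀ᵐ z ∂P, |m z.2 θ j| ≤ b₀) : ∀ᵐ x ∂(lawX P), |mbar θ x j| ≤ b₀ := by
  have h1 := ae_bdd_abs_condExp_of_ae_bdd_abs (m := sigmaX dX 𝒲) hb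
  have hmeas : MeasurableSet {x | |mbar θ x j| ≤ b₀} :=
    measurableSet_le ((EuclideanSpace.proj (𝕜 := ℝ) j).continuous.measurable.comp
      (hmbar.measurable θ hθ)).abs measurable_const
  rw [lawX, ae_map_iff measurable_fst.aemeasurable hmeas]
  filter_upwards [h1, hmbar.ae_eq θ hθ j] with z h2 h3
  change |mbar θ z.1 j| ≤ b₀
  rw [h3]
  exact h2

/-- Expectations of weighted moment functions in terms of the conditional mean. -/
theorem IsCondMean.integral_mul {P : Measure (Vec dX × 𝒲)} [IsProbabilityMeasure P]
    {m : 𝒲 → Vec d → Vec dY} {Θ : Set (Vec d)} {mbar : Vec d → Vec dX → Vec dY}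
    (hmbar : IsCondMean P m Θ mbar) {θ : Vec d} (hθ : θ ∈ Θ) (hm : Measurable fun w => m w θ)
    {j : Fin dY} {b₀ : ℝ} (hb : ∀ᵐ z ∂P, |m z.2 θ j| ≤ b₀) {g : Vec dX → ℝ} (hg : Measurable g)
    {gbar : ℝ} (hgb : ∀ x, |g x| ≤ gbar) :
    ∫ z, m z.2 θ j * g z.1 ∂P = ∫ x, mbar θ x j * g x ∂(lawX P) := by
  have hle : sigmaX dX 𝒲 ≤ Prod.instMeasurableSpace := measurable_fst.comap_le
  have hgs : StronglyMeasurable[sigmaX dX 𝒲] fun z : Vec dX × 𝒲 => g z.1 :=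
    (hg.comp (comap_measurable (m := inferInstance) Prod.fst)).stronglyMeasurable
  have hmi := integrable_moment hm hb
  have hmg : Integrable ((fun z : Vec dX × 𝒲 => m z.2 θ j) * fun z => g z.1) P :=
    hmi.mul_bdd (c := gbar) (hg.comp measurable_fst).aestronglyMeasurable (.of_forall fun z => hgb _)
  have h1 := condExp_mul_of_stronglyMeasurable_right hgs hmg hmi
  have h2 : Measurable fun x => mbar θ x j :=
    (EuclideanSpace.proj (𝕜 := ℝ) j).continuous.measurable.comp (hmbar.measurable θ hθ)
  calc ∫ z, m z.2 θ j * g z.1 ∂P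
      = ∫ z, (P[(fun z : Vec dX × 𝒲 => m z.2 θ j) * fun z => g z.1 | sigmaX dX 𝒲]) z ∂P :=
        (integral_condExp hle).symm
    _ = ∫ z, mbar θ z.1 j * g z.1 ∂P := by
        refine integral_congr_ae ?_
        filter_upwards [h1, hmbar.ae_eq θ hθ j] with z h3 h4
        rw [h3, h4]; rfl
    _ = _ := integral_comp_fst P (h2.mul hg)

/-- A function with growth of order `α` away from a point has kernel averages of order `h ^ α`. -/
theorem exists_le_integral_mul_dilate (hdX : 0 < dX) {ν : Measure (Vec dX)}
    [IsProbabilityMeasure ν] {fbar : ℝ} (hf : 0 < fbar) (hν : ν ≤ ENNReal.ofReal fbar • volume)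
    {k : Vec dX → ℝ} (hk : Measurable k) (hk0 : ∀ t, 0 ≤ k t) {kbar : ℝ} (hkb : ∀ t, k t ≤ kbar)
    {κ ρ : ℝ} (hκ : 0 < κ) (hρ : 0 < ρ) (hkρ : ∀ t, ‖t‖ ≤ ρ → κ ≤ k t) {η ε₀ : ℝ} (hη : 0 < η)
    (hε₀ : 0 < ε₀) (hsupp : ∀ ε : ℝ, 0 < ε → ε ≤ ε₀ → ∀ x ∈ ν.support,
      η * ε ^ dX ≤ ν.real (Metric.closedBall x ε))
    {φ : Vec dX → ℝ} (hφ : Integrable φ ν) {α : ℝ} (hα : 0 < α) {x₀ : Vec dX} {e : ℝ} (he : 0 < e)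
    (hgrow : ∀ x ∈ ν.support, e * min (‖x - x₀‖ ^ α) e ≤ φ x) :
    ∃ c > 0, ∃ h₀ > 0, ∀ h, 0 < h → h ≤ h₀ → ∀ x ∈ ν.support,
      c * h ^ α * h ^ dX ≤ ∫ t, φ t * dilate k x h t ∂ν := by
  set ω := (volume : Measure (Vec dX)).real (Metric.ball 0 1)
  have hω : 0 ≤ ω := measureReal_nonneg
  -- `q` is chosen so that a ball of radius `s * h` has at most half of the mass guaranteed to a
  -- ball of radius `ρ * h` about a support point. As `q ≤ 1` and `dX` is positive, `q ^ dX ≤ q`.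
  set q := min 1 (η / (2 * (fbar * ω + 1)))
  have hq : 0 < q := by positivity
  set s := ρ * q
  have hs : 0 < s := by positivity
  have hsd : fbar * ω * s ^ dX ≤ η * ρ ^ dX / 2 := by
    have h1 : q ^ dX ≤ q := pow_le_of_le_one hq.le (min_le_left _ _) hdX.ne'
    have h2 : fbar * ω * q ≤ η / 2 := by
      calc fbar * ω * q ≤ (fbar * ω + 1) * (η / (2 * (fbar * ω + 1))) := by
            gcongr
            · linarith
            · exact min_le_right _ _
        _ = η / 2 := by field_simp
    calc fbar * ω * s ^ dX = fbar * ω * q ^ dX * ρ ^ dX := by rw [mul_pow]; ring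
      _ ≤ fbar * ω * q * ρ ^ dX := by gcongr
      _ ≤ η / 2 * ρ ^ dX := by gcongr
      _ = _ := by ring
  refine ⟨e * s ^ α * κ * (η * ρ ^ dX / 2), by positivity, min (ε₀ / ρ) (e ^ α⁻¹ / s),
    by positivity, fun h hh hh₀ x hx => ?_⟩
  have hρh : ρ * h ≤ ε₀ := by
    have := hh₀.trans (min_le_left _ _)
    rwa [le_div_iff₀ hρ, mul_comm] at this
  have hsh : (s * h) ^ α ≤ e := by
    have h1 := hh₀.trans (min_le_right _ _)
    rw [le_div_iff₀ hs, mul_comm] at h1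
    calc (s * h) ^ α ≤ (e ^ α⁻¹) ^ α := by gcongr
      _ = e := Real.rpow_inv_rpow he.le hα.ne'
  -- On `E` the kernel is at least `κ` and `φ` at least `e * (s * h) ^ α`, wherever `x` lies
  -- relative to `x₀`.
  set E := Metric.closedBall x (ρ * h) \ Metric.ball x₀ (s * h)
  have hE : MeasurableSet E :=
    Metric.isClosed_closedBall.measurableSet.diff Metric.isOpen_ball.measurableSet
  have hball : ν.real (Metric.ball x₀ (s * h)) ≤ fbar * ω * (s * h) ^ dX := by
    have h1 : ν (Metric.ball x₀ (s * h)) ≤ ENNReal.ofReal fbar *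
        (ENNReal.ofReal ((s * h) ^ dX) * volume (Metric.ball (0 : Vec dX) 1)) := by
      refine (hν _).trans (le_of_eq ?_)
      rw [Measure.smul_apply, smul_eq_mul, Measure.addHaar_ball_of_pos _ _ (by positivity),
        finrank_euclideanSpace_fin]
    have h2 := ENNReal.toReal_mono (ENNReal.mul_ne_top (by simp)
      (ENNReal.mul_ne_top (by simp) measure_ball_lt_top.ne)) h1
    rw [ENNReal.toReal_mul, ENNReal.toReal_mul, ENNReal.toReal_ofReal hf.le,
      ENNReal.toReal_ofReal (by positivity)] at h2
    refine h2.trans (le_of_eq ?_)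
    simp only [ω, Measure.real]; ring
  have hEν : η * ρ ^ dX / 2 * h ^ dX ≤ ν.real E := by
    have h1 : ν.real (Metric.closedBall x (ρ * h)) ≤
        ν.real E + ν.real (Metric.ball x₀ (s * h)) := by
      refine (measureReal_mono (fun y hy => ?_)).trans (measureReal_union_le _ _)
      by_cases hy' : y ∈ Metric.ball x₀ (s * h)
      exacts [.inr hy', .inl ⟨hy, hy'⟩]
    have h2 := hsupp (ρ * h) (by positivity) hρh x hx
    have h3 : fbar * ω * (s * h) ^ dX ≤ η * ρ ^ dX / 2 * h ^ dX := by
      rw [mul_pow, ← mul_assoc]; gcongr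
    rw [mul_pow] at h2
    linarith
  have hdm : Measurable (dilate k x h) := (measurable_dilate hk h).comp measurable_prodMk_left
  have hint : Integrable (fun t => φ t * dilate k x h t) ν :=
    hφ.mul_bdd (c := kbar) hdm.aestronglyMeasurable (.of_forall fun t => by
      rw [Real.norm_of_nonneg (show 0 ≤ dilate k x h t from hk0 _)]; exact hkb _)
  calc e * s ^ α * κ * (η * ρ ^ dX / 2) * h ^ α * h ^ dX
      = e * (s * h) ^ α * κ * (η * ρ ^ dX / 2 * h ^ dX) := by
        rw [Real.mul_rpow hs.le hh.le]; ring
    _ ≤ e * (s * h) ^ α * κ * ν.real E := by gcongr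
    _ = ∫ t, E.indicator (fun _ => e * (s * h) ^ α * κ) t ∂ν := by
        rw [integral_indicator_const _ hE, smul_eq_mul, mul_comm]
    _ ≤ ∫ t, φ t * dilate k x h t ∂ν := by
        refine integral_mono_ae ((integrable_indicator_iff hE).2 (integrable_const _).integrableOn)
          hint ?_
        filter_upwards [Measure.support_mem_ae (μ := ν)] with t ht
        have hφt := hgrow t ht
        have hφ0 : 0 ≤ φ t := le_trans (by positivity) hφt
        by_cases htE : t ∈ E
        · rw [indicator_of_mem htE]
          have h1 : (s * h) ^ α ≤ ‖t - x₀‖ ^ α := by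
            have : s * h ≤ dist t x₀ := not_lt.1 htE.2
            rw [dist_eq_norm] at this
            gcongr
          have h2 : κ ≤ dilate k x h t := by
            refine hkρ _ ?_
            rw [norm_smul, norm_inv, Real.norm_of_nonneg hh.le, ← dist_eq_norm,
              inv_mul_le_iff₀ hh, mul_comm]
            exact htE.1
          have h3 : e * (s * h) ^ α ≤ φ t :=
            le_trans (by gcongr; exact le_min h1 hsh) hφt
          gcongr
        · rw [indicator_of_notMem htE]
          exact mul_nonneg hφ0 (hk0 _)

theorem exists_pos_le_of_finite {ι : Type*} [Finite ι] {f : ι → ℝ} (hf : ∀ i, 0 < f i) :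
    ∃ c > 0, ∀ i, c ≤ f i := by
  cases isEmpty_or_nonempty ι
  · exact ⟨1, one_pos, fun i => isEmptyElim i⟩
  · obtain ⟨i, hi⟩ := Finite.exists_min f
    exact ⟨f i, hf i, hi⟩

/-- At a boundary point, each component of the conditional mean grows at least at rate `α` away
from some point. -/
theorem LocalSmoothness.exists_growth {P : Measure (Vec dX × 𝒲)} {mbar : Vec d → Vec dX → Vec dY}
    {Θ₀ : Set (Vec d)} {α r : ℝ} {θ₀ : Vec d} (hl : LocalSmoothness P mbar Θ₀ α θ₀ r)
    {θ : Vec d} (hθ : θ ∈ Θ₀) (hθf : θ ∈ frontier Θ₀ ∩ Metric.ball θ₀ r) (j : Fin dY) :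
    ∃ x₀ : Vec dX, ∃ e > 0, ∀ x ∈ suppX P, e * min (‖x - x₀‖ ^ α) e ≤ mbar θ x j := by
  obtain ⟨x₀, hx₀, hmin⟩ := hl.min_attained θ hθf j
  have hnn := hl.nonneg_on_support θ ⟨hθ, hθf.2⟩
  -- A zero minimum makes `x₀` a contact point, where the growth condition applies. A positive
  -- minimum bounds the component below by a constant, which is stronger.
  rcases (hnn x₀ hx₀ j).eq_or_lt with h0 | hpos
  · obtain ⟨e, he, hgrow⟩ := hl.growth
    refine ⟨x₀, e, he, fun x hx => ?_⟩
    have hc : x₀ ∈ contactSet P mbar θ := by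
      refine ⟨hx₀, ⟨j, h0.symm⟩, ?_⟩
      rintro _ ⟨i, rfl⟩
      exact hnn x₀ hx₀ i
    have := hgrow θ hθf x₀ hc x hx j
    rwa [← h0, sub_zero, abs_of_nonneg (hnn x hx j)] at this
  · refine ⟨x₀, min 1 (mbar θ x₀ j), by positivity, fun x hx => ?_⟩
    set e := min 1 (mbar θ x₀ j)
    have he : 0 < e := by positivity
    calc e * min (‖x - x₀‖ ^ α) e ≤ e * 1 := by
          gcongr
          exact (min_le_right _ _).trans (min_le_left _ _)
      _ ≤ mbar θ x₀ j := by rw [mul_one]; exact min_le_right _ _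
      _ ≤ mbar θ x j := hmin hx

/-- Lower bound for the population kernel averages near a boundary point of the identified set. -/
theorem exists_le_integral_moment_mul_dilate (hdX : 0 < dX) {P : Measure (Vec dX × 𝒲)}
    [IsProbabilityMeasure P] {m : 𝒲 → Vec d → Vec dY} {Θ : Set (Vec d)}
    (hm : ∀ θ ∈ Θ, Measurable fun w => m w θ) {mbar : Vec d → Vec dX → Vec dY}
    (hmbar : IsCondMean P m Θ mbar) {α r : ℝ} (hα : 0 < α) {θ₀ : Vec d}
    (hr : Metric.ball θ₀ r ⊆ Θ)
    (hl : LocalSmoothness P mbar (identifiedSet P m Θ) α θ₀ r)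
    {fbar : ℝ} (hf : 0 < fbar) (hν : lawX P ≤ ENNReal.ofReal fbar • volume)
    {k : Vec dX → ℝ} (hk : Measurable k) (hk0 : ∀ t, 0 ≤ k t) (hki : Integrable k)
    (hk1 : ∫ t, k t = 1) {kbar : ℝ} (hkb : ∀ t, k t ≤ kbar)
    {κ ρ : ℝ} (hκ : 0 < κ) (hρ : 0 < ρ) (hkρ : ∀ t, ‖t‖ ≤ ρ → κ ≤ k t) {η ε₀ : ℝ} (hη : 0 < η)
    (hε₀ : 0 < ε₀) (hsupp : ∀ ε : ℝ, 0 < ε → ε ≤ ε₀ → ∀ x ∈ suppX P,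
      η ≤ (lawX P).real (Metric.closedBall x ε) / ε ^ dX) {b₀ : ℝ}
    (hb : ∀ θ ∈ Θ, ∀ j, ∀ᵐ z ∂P, |m z.2 θ j| ≤ b₀)
    {θb : Vec d} (hθb : θb ∈ identifiedSet P m Θ)
    (hθf : θb ∈ frontier (identifiedSet P m Θ) ∩ Metric.ball θ₀ r) :
    ∃ M > 0, ∃ c > 0, ∃ h₀ > 0, ∀ h, 0 < h → h ≤ h₀ → ∀ θ ∈ Metric.ball θ₀ r, ∀ j, ∀ x ∈ suppX P,
      (c * h ^ α - M * dist θ θb) * h ^ dX ≤ ∫ z, m z.2 θ j * dilate k x h z.1 ∂P := by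
  have hprob : IsProbabilityMeasure (lawX P) :=
    Measure.isProbabilityMeasure_map measurable_fst.aemeasurable
  have hmj : ∀ θ ∈ Θ, ∀ j, Measurable fun x => mbar θ x j := fun θ hθ j =>
    (EuclideanSpace.proj (𝕜 := ℝ) j).continuous.measurable.comp (hmbar.measurable θ hθ)
  have hint : ∀ θ ∈ Θ, ∀ j, Integrable (fun x => mbar θ x j) (lawX P) := fun θ hθ j =>
    Integrable.of_bound (hmj θ hθ j).aestronglyMeasurable b₀ (hmbar.ae_abs_le hθ (hb θ hθ j))
  have hsupp' : ∀ ε : ℝ, 0 < ε → ε ≤ ε₀ → ∀ x ∈ suppX P,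
      η * ε ^ dX ≤ (lawX P).real (Metric.closedBall x ε) := fun ε h1 h2 x hx =>
    (le_div_iff₀ (by positivity)).1 (hsupp ε h1 h2 x hx)
  have hex : ∀ j, ∃ c > 0, ∃ h₀ > 0, ∀ h, 0 < h → h ≤ h₀ → ∀ x ∈ suppX P,
      c * h ^ α * h ^ dX ≤ ∫ t, mbar θb t j * dilate k x h t ∂(lawX P) := by
    intro j
    obtain ⟨x₀, e, he, hgrow⟩ := hl.exists_growth hθb hθf j
    exact exists_le_integral_mul_dilate hdX hf hν hk hk0 hkb hκ hρ hkρ hη hε₀ hsupp'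
      (hint θb hθb.1 j) hα he hgrow
  choose c hc h₀ hh₀ hbound using hex
  obtain ⟨c', hc', hcc⟩ := exists_pos_le_of_finite hc
  obtain ⟨h', hh', hhh⟩ := exists_pos_le_of_finite hh₀
  obtain ⟨M, hM⟩ := hl.deriv_bounded
  set M' := max M 1
  refine ⟨M' * fbar, by positivity, c', hc', h', hh', fun h hh hle θ hθ j x hx => ?_⟩
  have hdm : Measurable (dilate k x h) := (measurable_dilate hk h).comp measurable_prodMk_left
  have hd0 : ∀ t, 0 ≤ dilate k x h t := fun t => hk0 _
  have hdb : ∀ t, |dilate k x h t| ≤ kbar := fun t => by rw [abs_of_nonneg (hd0 t)]; exact hkb _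
  have hdi : Integrable (dilate k x h) (lawX P) :=
    Integrable.of_bound hdm.aestronglyMeasurable kbar (.of_forall hdb)
  have hprod : ∀ θ ∈ Θ, Integrable (fun t => mbar θ t j * dilate k x h t) (lawX P) := fun θ hθ =>
    (hint θ hθ j).mul_bdd (c := kbar) hdm.aestronglyMeasurable (.of_forall hdb)
  -- The mean value inequality on the convex ball, with a constant that does not depend on `t`.
  have hlip : ∀ t ∈ suppX P, mbar θb t j - M' * dist θ θb ≤ mbar θ t j := by
    intro t ht
    have h1 := (convex_ball θ₀ r).norm_image_sub_le_of_norm_fderiv_le (𝕜 := ℝ)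
      (f := fun θ' => mbar θ' t) (C := M') (fun θ' hθ' => hl.differentiable θ' hθ' t ht)
      (fun θ' hθ' => (hM θ' hθ' t ht).trans (le_max_left _ _)) hθf.2 hθ
    have h2 : |mbar θ t j - mbar θb t j| ≤ ‖mbar θ t - mbar θb t‖ :=
      PiLp.norm_apply_le (mbar θ t - mbar θb t) j
    rw [← dist_eq_norm θ] at h1
    linarith [(abs_le.1 (h2.trans h1)).1]
  rw [hmbar.integral_mul (hr hθ) (hm θ (hr hθ)) (hb θ (hr hθ) j) hdm hdb]
  calc (c' * h ^ α - M' * fbar * dist θ θb) * h ^ dX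
      = c' * h ^ α * h ^ dX - M' * dist θ θb * (fbar * h ^ dX) := by ring
    _ ≤ c j * h ^ α * h ^ dX - M' * dist θ θb * ∫ t, dilate k x h t ∂(lawX P) := by
        gcongr
        · exact hcc j
        · exact integral_dilate_le hf hν hki hk0 hk1 x hh
    _ ≤ (∫ t, mbar θb t j * dilate k x h t ∂(lawX P)) -
          M' * dist θ θb * ∫ t, dilate k x h t ∂(lawX P) := by
        gcongr
        exact hbound j h hh (hle.trans (hhh j)) x hx
    _ = ∫ t, (mbar θb t j * dilate k x h t - M' * dist θ θb * dilate k x h t) ∂(lawX P) := by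
        rw [integral_sub (hprod θb hθb.1) (hdi.const_mul _), integral_const_mul]
    _ ≤ ∫ t, mbar θ t j * dilate k x h t ∂(lawX P) := by
        refine integral_mono_ae ((hprod θb hθb.1).sub (hdi.const_mul _)) (hprod θ (hr hθ)) ?_
        filter_upwards [Measure.support_mem_ae (μ := lawX P)] with t ht
        have := mul_le_mul_of_nonneg_right (hlip t ht) (hd0 t)
        linarith

/-! ### From kernel sums to the set estimate. -/

/-- Membership in the set estimate from bounds on the kernel sums. -/
theorem mem_kernSet_of_sum_bounds {P : Measure (Vec dX × 𝒲)} {m : 𝒲 → Vec d → Vec dY}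
    {Θ : Set (Vec d)} {S : Vec dY → ℝ} {K₁ : ℝ}
    (hS : ∀ c : ℝ, 0 < c → ∀ t : Vec dY, c ≤ S t → ∃ j, t j ≤ -(c * K₁)) {k : Vec dX → ℝ}
    {h : ℝ} {n : ℕ} (hn : 0 < n) {z : ℕ → Vec dX × 𝒲} {θ : Vec d} (hθ : θ ∈ Θ)
    (hscale : 0 < kernScale dX n h) {c u v : ℝ} (hc : 0 < c) (hu : 0 ≤ u) (hv : 0 < v)
    (huv : u / v < c / kernScale dX n h * K₁)
    (hden : ∀ x ∈ suppX P, v ≤ ∑ i ∈ Finset.range n, dilate k x h (z i).1)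
    (hnum : ∀ x ∈ suppX P, ∀ j, -u ≤ ∑ i ∈ Finset.range n, m (z i).2 θ j * dilate k x h (z i).1) :
    θ ∈ kernSet P m Θ S k h n z c := by
  refine ⟨hθ, ?_⟩
  rw [← le_div_iff₀' hscale]
  -- The nonnegative bound also covers an empty support, where the supremum takes the default value
  -- `0`.
  refine Real.sSup_le ?_ (by positivity)
  rintro _ ⟨x, hx, rfl⟩
  by_contra! hlt
  obtain ⟨j, hj⟩ := hS _ (by positivity) _ hlt.le
  have hn' : (n : ℝ) ≠ 0 := by positivity
  have hk : kernMean m k h n z θ x j = (∑ i ∈ Finset.range n, m (z i).2 θ j * dilate k x h (z i).1) /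
      ∑ i ∈ Finset.range n, dilate k x h (z i).1 := by
    simp only [kernMean, empMean]
    exact div_div_div_cancel_right₀ hn' _ _
  have hd := hden x hx
  have h1 : -(u / v) ≤ kernMean m k h n z θ x j := by
    rw [hk, le_div_iff₀ (hv.trans_le hd)]
    refine le_trans ?_ (hnum x hx j)
    rw [neg_mul, neg_le_neg_iff, div_mul_eq_mul_div, le_div_iff₀ hv]
    gcongr
  linarith

/-- Identifies the deviation rate of the kernel averages, relative to `h ^ dX`, as the reciprocal of
the normalizing factor of the estimate. -/
theorem sqrt_eq_div_kernScale {n : ℕ} {h : ℝ} (hn : 0 < Real.log n) (hh : 0 < h) :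
    √(h ^ dX * Real.log n / n) = h ^ dX / kernScale dX n h := by
  have hn0 : 0 < (n : ℝ) := by
    rcases Nat.eq_zero_or_pos n with rfl | h0
    · simp at hn
    · exact_mod_cast h0
  have hhd : 0 < h ^ dX := by positivity
  rw [kernScale, div_div_eq_mul_div, eq_div_iff (by positivity), ← Real.sqrt_mul (by positivity)]
  rw [Real.sqrt_eq_iff_eq_sq (by positivity) (by positivity), mul_pow, Real.sq_sqrt hn.le]
  field_simp

/-- The law of the first `n` observations bounds the probability of events that depend on them. -/
theorem measure_preimage_sample_le {Ω 𝒵 : Type*} [MeasurableSpace Ω] [MeasurableSpace 𝒵]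
    {μ : Measure Ω} [IsProbabilityMeasure μ] {P : Measure 𝒵} {Z : ℕ → Ω → 𝒵}
    (hZ : ∀ i, Measurable (Z i)) (hind : iIndepFun Z μ) (hP : ∀ i, μ.map (Z i) = P) (n : ℕ)
    (s : Set (Fin n → 𝒵)) :
    μ {ω | (fun i : Fin n => Z i ω) ∈ s} ≤ (Measure.pi fun _ : Fin n => P) s := by
  have hm : Measurable fun ω => fun i : Fin n => Z i ω := measurable_pi_lambda _ fun i => hZ i
  have h1 : μ.map (fun ω => fun i : Fin n => Z i ω) = Measure.pi fun _ : Fin n => P := by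
    have h2 := (iIndepFun_iff_map_fun_eq_pi_map fun i : Fin n => (hZ i).aemeasurable).1
      (hind.precomp Fin.val_injective)
    rw [h2]
    simp [hP]
  rw [← h1]
  exact Measure.le_map_apply hm.aemeasurable s

end CondMoment
end

/-! ### The rate bound for the set estimate. -/

set_option maxHeartbeats 1600000 in
theorem mainTheorem7 {dX dY d : ℕ} (hdX : 0 < dX) {𝒲 : Type*} [MeasurableSpace 𝒲]
    (P : Measure (Vec dX × 𝒲)) [IsProbabilityMeasure P]
    (Θ : Set (Vec d)) (m : 𝒲 → Vec d → Vec dY) (hm : ∀ θ ∈ Θ, Measurable fun w => m w θ)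
    (mbar : Vec d → Vec dX → Vec dY) (hmbar : CondMoment.IsCondMean P m Θ mbar)
    (S : Vec dY → ℝ) (hS : CondMoment.SCondition S)
    (k : Vec dX → ℝ) (Ybar : ℝ) (hYbar : 0 ≤ Ybar)
    (hk : CondMoment.KernelCondition m Θ Ybar k)
    (hbdd : CondMoment.BoundedCondition P m Θ (CondMoment.kernelClass k) Ybar)
    (hsupp : CondMoment.SupportCondition P)
    (α : ℝ) (hα : 0 < α) (hsmooth : CondMoment.SmoothnessUpperCondition P m Θ mbar α) :
    ∃ a c : ℝ, 0 < a ∧ 0 < c ∧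
      ∀ (Ω : Type*) [MeasurableSpace Ω] (μ : Measure Ω) [IsProbabilityMeasure μ]
        (Z : ℕ → Ω → Vec dX × 𝒲),
        (∀ i, Measurable (Z i)) → iIndepFun Z μ → (∀ i, μ.map (Z i) = P) →
      ∀ (h : ℕ → ℝ) (chat : ℕ → Ω → ℝ),
        (∀ n, 0 < h n) → Tendsto h atTop (𝓝 0) →
        (∀ᶠ n : ℕ in atTop, a ≤ h n ^ dX * n / Real.log n) →
        CondMoment.WithProbToOne μ (fun n => {ω | c ≤ chat n ω}) →
      ∃ ε : ℝ, 0 < ε ∧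
        CondMoment.WithProbToOne μ (fun n => {ω |
          ENNReal.ofReal ε ≤
            ENNReal.ofReal (min (CondMoment.kernScale dX n (h n)) (h n ^ (-α))) *
              Metric.hausdorffEDist
                (CondMoment.kernSet P m Θ S k (h n) n (fun i => Z i ω) (chat n ω))
                (CondMoment.identifiedSet P m Θ)}) := by
  open CondMoment in
  obtain ⟨K₁, K₂, hK₁, -, hgrowS⟩ := hS.growth
  obtain ⟨κ, hκ, hkκ⟩ := hk.lower_bound
  obtain ⟨ρ, hρ, hkρ⟩ := Metric.nhds_basis_closedBall.eventually_iff.1 hkκ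
  replace hkρ : ∀ t, ‖t‖ ≤ ρ → κ ≤ k t := fun t ht => hkρ (by simpa using ht)
  obtain ⟨kbar, hkbar, hkb⟩ : ∃ kbar > 0, ∀ t, k t ≤ kbar := by
    obtain ⟨kb, hkb⟩ := hk.bounded
    exact ⟨max kb 1, by positivity, fun t => (hkb t).trans (le_max_left _ _)⟩
  obtain ⟨A, V, hA, hV, hcov⟩ := hk.covering
  obtain ⟨η, hη, ε₀, hε₀, hsuppη⟩ := hsupp
  obtain ⟨fbar, hf, hν⟩ := exists_le_smul_volume hsmooth.bounded_density
  obtain ⟨θ₀, hθ₀, r, hr, hball, hl⟩ := hsmooth.smooth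
  set b₀ := Ybar / κ + 1
  have hb₀ : 0 < b₀ := by positivity
  have hb : ∀ θ ∈ Θ, ∀ j, ∀ᵐ z ∂P, |m z.2 θ j| ≤ b₀ := fun θ hθ j =>
    (ae_abs_moment_le hκ hkκ hbdd hθ j).mono fun z hz => hz.trans (by simp [b₀])
  obtain ⟨θb, ⟨hθb, hθf⟩, D, hD, g, hg⟩ := exists_segment_leaving hθ₀ hr
    (hl.mem_of_mem_closure hmbar hball)
  obtain ⟨M, hM, c₂, hc₂, h₀, hh₀, hbias⟩ := exists_le_integral_moment_mul_dilate hdX hm hmbar hα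
    hball hl hf hν hk.measurable hk.nonneg hk.integrable hk.integral_eq_one hkb hκ hρ hkρ hη hε₀
    hsuppη hb hθb hθf
  set cv := b₀ ^ 2 * kbar * fbar
  have hcv : 0 < cv := by positivity
  set K := 32 + 6 * cv + 32 * (b₀ * kbar) ^ 2 * (V + 1) with hKdef
  have hK0 : 0 ≤ 32 * (b₀ * kbar) ^ 2 * (V + 1) := by positivity
  have hK32 : 32 ≤ K := by linarith
  set C := 32 + 16 * cv + 128 * K * (V + 1) with hCdef
  have hC0 : 0 ≤ 128 * K * (V + 1) := by positivity
  have hC32 : 32 ≤ C := by linarith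
  have hCsq : C ≤ C ^ 2 := by nlinarith
  set w := η * (ρ / 2) ^ dX
  have hw : 0 < w := by positivity
  set a := 1 + 8 / w
  have ha1 : 1 ≤ a := by simp only [a]; linarith [show 0 < 8 / w by positivity]
  have haw : 8 ≤ w * a := by
    have : w * a = w + 8 := by simp only [a]; field_simp
    linarith
  set c₃ := κ * (w / 4)
  have hc₃ : 0 < c₃ := by positivity
  -- On the good event the estimated moments are at least `-(1 + C) / (c₃ * scale)`; the factor `2`
  -- makes the comparison with the critical value strict.
  set c := 2 * (1 + C) / (c₃ * K₁)
  have hc : 0 < c := by positivity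
  refine ⟨a, c, by linarith, hc, ?_⟩
  intro Ω _ μ _ Z hZ hind hP h chat hh hlim hah hchat
  -- `D` keeps the point on the segment, `c₂ / M` lets the bias absorb the `h ^ α` part of the
  -- displacement, and `1 / M` limits the rest to `1 / scale`.
  set ε := min D (min (c₂ / M) (1 / M))
  have hε : 0 < ε := by positivity
  refine ⟨ε, hε, ?_⟩
  -- Below `hstar` the bias and support bounds apply and the net radii are below `1`, as the
  -- covering condition requires.
  set hstar := min (min 1 h₀) (min (2 * ε₀ / ρ) (min (31 / K) (31 / C)))
  have hstar0 : 0 < hstar := by positivity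
  set R := 1 / (η * (ρ / 4) ^ dX)
  have hbound : ∀ᶠ n : ℕ in atTop, μ {ω | ENNReal.ofReal ε ≤
      ENNReal.ofReal (min (kernScale dX n (h n)) (h n ^ (-α))) *
        Metric.hausdorffEDist (kernSet P m Θ S k (h n) n (fun i => Z i ω) (chat n ω))
          (identifiedSet P m Θ)}ᶜ ≤
      μ {ω | c ≤ chat n ω}ᶜ +
        (ENNReal.ofReal (R / n) + dY * (4 * ENNReal.ofReal (A / n))) := by
    have hlog : ∀ᶠ n : ℕ in atTop, 1 ≤ Real.log n :=
      (Real.tendsto_log_atTop.comp tendsto_natCast_atTop_atTop).eventually_ge_atTop 1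
    filter_upwards [hah, hlog, hlim.eventually (gt_mem_nhds hstar0)] with n han hn hhn
    have hn0 : 0 < (n : ℝ) := by
      rcases Nat.eq_zero_or_pos n with rfl | h0
      · simp at hn; linarith
      · exact_mod_cast h0
    have hhn0 := hh n
    set H := h n
    have hHd : 0 < H ^ dX := by positivity
    have hH1 : H ≤ 1 := hhn.le.trans ((min_le_left _ _).trans (min_le_left _ _))
    have hHh₀ : H ≤ h₀ := hhn.le.trans ((min_le_left _ _).trans (min_le_right _ _))
    have hHε₀ : ρ * H / 2 ≤ ε₀ := by
      have := hhn.le.trans ((min_le_right _ _).trans (min_le_left _ _))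
      rw [le_div_iff₀ hρ] at this
      linarith
    have hHdH : H ^ dX ≤ H := pow_le_of_le_one hhn0.le hH1 hdX.ne'
    have hHK : K * H ^ dX < 32 := by
      have := hhn.le.trans ((min_le_right _ _).trans ((min_le_right _ _).trans (min_le_left _ _)))
      rw [le_div_iff₀ (by positivity)] at this
      have h1 : K * H ^ dX ≤ K * H := by gcongr
      linarith
    have hHC : C * H ^ dX < 32 := by
      have := hhn.le.trans ((min_le_right _ _).trans ((min_le_right _ _).trans (min_le_right _ _)))
      rw [le_div_iff₀ (by positivity)] at this
      have h1 : C * H ^ dX ≤ C * H := by gcongr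
      linarith
    have hanH : a * Real.log n ≤ n * H ^ dX := by
      rw [le_div_iff₀ (by linarith)] at han
      linarith
    have hnH : Real.log n ≤ n * H ^ dX := le_trans (le_mul_of_one_le_left (by linarith) ha1) hanH
    set sc := kernScale dX n H with hsc
    have hsc1 : 1 ≤ sc := by
      rw [hsc, kernScale, le_div_iff₀ (by positivity), one_mul]
      exact Real.sqrt_le_sqrt hnH
    have hδ : √(H ^ dX * Real.log n / n) = H ^ dX / sc :=
      sqrt_eq_div_kernScale (by linarith) hhn0
    have hCδ : C * √(H ^ dX * Real.log n / n) < 32 := by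
      rw [hδ]
      refine lt_of_le_of_lt ?_ hHC
      gcongr
      exact div_le_self hHd.le hsc1
    have hHα : 1 ≤ H ^ (-α) := Real.one_le_rpow_of_pos_of_le_one_of_nonpos hhn0 hH1 (by linarith)
    set mn := min sc (H ^ (-α))
    have hmn : 1 ≤ mn := le_min hsc1 hHα
    set t := ε / mn with ht
    have htε : t ≤ ε := div_le_self hε.le hmn
    have ht0 : 0 ≤ t := by positivity
    -- The reciprocal of a minimum is the maximum of the reciprocals, hence at most their sum.
    have htsum : t ≤ ε / sc + ε * H ^ α := by
      rcases min_choice sc (H ^ (-α)) with h1 | h1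
      · rw [ht, show mn = sc from h1]
        exact le_add_of_nonneg_right (by positivity)
      · rw [ht, show mn = H ^ (-α) from h1, Real.rpow_neg hhn0.le, div_inv_eq_mul]
        exact le_add_of_nonneg_left (by positivity)
    obtain ⟨hgb, hgd, hgs⟩ := hg t ht0 (htε.trans (min_le_left _ _))
    set θ := g t
    have hθΘ : θ ∈ Θ := hball hgb
    have hE : ∀ j, ∀ x ∈ suppX P, -(H ^ dX / sc) ≤ ∫ z, m z.2 θ j * dilate k x H z.1 ∂P := by
      intro j x hx
      refine le_trans ?_ (hbias H hhn0 hHh₀ θ hgb j x hx)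
      have h1 : M * ε ≤ c₂ := by
        have := (min_le_right D _).trans (min_le_left (c₂ / M) (1 / M))
        rwa [le_div_iff₀' hM] at this
      have h2 : M * ε ≤ 1 := by
        have := (min_le_right D _).trans (min_le_right (c₂ / M) (1 / M))
        rwa [le_div_iff₀' hM] at this
      have h3 : M * dist θ θb ≤ c₂ * H ^ α + 1 / sc := by
        calc M * dist θ θb ≤ M * (ε / sc + ε * H ^ α) := by gcongr; exact hgd.trans htsum
          _ = M * ε * H ^ α + M * ε / sc := by ring
          _ ≤ c₂ * H ^ α + 1 / sc := by gcongr
      calc -(H ^ dX / sc) = -(1 / sc) * H ^ dX := by ring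
        _ ≤ _ := by gcongr; linarith
    let bad : Set (Fin n → Vec dX × 𝒲) := {z | ∃ x ∈ suppX P, ∑ i, dilate k x H (z i).1 <
        n * (κ * (η * (ρ / 2) ^ dX / 4) * H ^ dX)}
    let badN : Fin dY → Set (Fin n → Vec dX × 𝒲) := fun j =>
      {z | ∃ x, ∑ i, m (z i).2 θ j * dilate k x H (z i).1 <
        n * (∫ z, m z.2 θ j * dilate k x H z.1 ∂P) - n * (C * √(H ^ dX * Real.log n / n))}
    have hbad : (Measure.pi fun _ : Fin n => P) bad ≤ ENNReal.ofReal (R / n) :=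
      measure_exists_kernel_density_lt_le P hk.nonneg hκ hρ hkρ hη hsuppη hhn0 hHε₀ ha1 haw hn hanH
    have hbadN : ∀ j, (Measure.pi fun _ : Fin n => P) (badN j) ≤ 4 * ENNReal.ofReal (A / n) :=
      fun j => measure_exists_kernel_sum_lt_le P hθΘ (hm θ hθΘ) j hk.measurable hk.nonneg hkb hkbar
        hb₀ (hb θ hθΘ j) hhn0
        (fun x => integral_dilate_le hf hν hk.integrable hk.nonneg hk.integral_eq_one x hhn0)
        hA hV (hcov j).1 (hcov j).2 hK32 (by linarith) (by linarith) hC32 (by linarith)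
        (by linarith) hn hnH hHK hCδ
    have hsub : {ω | ENNReal.ofReal ε ≤ ENNReal.ofReal mn *
        Metric.hausdorffEDist (kernSet P m Θ S k H n (fun i => Z i ω) (chat n ω))
          (identifiedSet P m Θ)}ᶜ ⊆
        {ω | c ≤ chat n ω}ᶜ ∪ ({ω | (fun i : Fin n => Z i ω) ∈ bad} ∪
          ⋃ j, {ω | (fun i : Fin n => Z i ω) ∈ badN j}) := by
      intro ω hω
      by_contra hcon
      simp only [mem_union, mem_iUnion, not_or, not_exists, mem_compl_iff, not_not] at hcon
      obtain ⟨h1, h2, h3⟩ := hcon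
      have h1 : c ≤ chat n ω := h1
      have hden : ∀ x ∈ suppX P, n * (c₃ * H ^ dX) ≤
          ∑ i ∈ Finset.range n, dilate k x H (Z i ω).1 := by
        intro x hx
        rw [Finset.sum_range]
        by_contra! hlt
        exact h2 ⟨x, hx, hlt⟩
      have hnum : ∀ x ∈ suppX P, ∀ j, -(n * ((1 + C) * (H ^ dX / sc))) ≤
          ∑ i ∈ Finset.range n, m (Z i ω).2 θ j * dilate k x H (Z i ω).1 := by
        intro x hx j
        rw [Finset.sum_range]
        by_contra! hlt
        refine h3 j ⟨x, lt_of_lt_of_le hlt ?_⟩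
        rw [hδ, ← mul_sub, ← mul_neg]
        gcongr
        linarith [hE j x hx]
      have hmem : θ ∈ kernSet P m Θ S k H n (fun i => Z i ω) c := by
        refine mem_kernSet_of_sum_bounds (fun c hc t => (hgrowS c hc t).1) (by exact_mod_cast hn0)
          hθΘ (by positivity) hc (by positivity) (by positivity) ?_ hden hnum
        have h4 : n * ((1 + C) * (H ^ dX / sc)) / (n * (c₃ * H ^ dX)) = (1 + C) / c₃ / sc := by
          field_simp
        have h5 : c / sc * K₁ = 2 * ((1 + C) / c₃ / sc) := by
          simp only [c]; field_simp
        rw [h4, ← hsc, h5]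
        have : 0 < (1 + C) / c₃ / sc := by positivity
        linarith
      have hmem' : θ ∈ kernSet P m Θ S k H n (fun i => Z i ω) (chat n ω) :=
        ⟨hmem.1, hmem.2.trans h1⟩
      refine hω ?_
      change ENNReal.ofReal ε ≤ ENNReal.ofReal mn * _
      have h6 : ENNReal.ofReal ε = ENNReal.ofReal mn * ENNReal.ofReal t := by
        rw [← ENNReal.ofReal_mul (by positivity), ht, mul_div_cancel₀ _ (by positivity)]
      rw [h6]
      gcongr
      -- One point of the estimate at distance at least `t` from the identified set suffices; this
      -- also covers an infinite Hausdorff distance.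
      refine le_trans ?_ (Metric.infEDist_le_hausdorffEDist_of_mem hmem')
      rw [Metric.le_infEDist]
      intro y hy
      rw [edist_dist]
      exact ENNReal.ofReal_le_ofReal (hgs y hy)
    refine (measure_mono hsub).trans ((measure_union_le _ _).trans ?_)
    gcongr
    refine (measure_union_le _ _).trans (add_le_add ?_ ?_)
    · exact (measure_preimage_sample_le hZ hind hP n bad).trans hbad
    · refine (measure_iUnion_fintype_le _ _).trans ?_
      calc _ ≤ ∑ _j : Fin dY, 4 * ENNReal.ofReal (A / n) := Finset.sum_le_sum fun j _ =>
            (measure_preimage_sample_le hZ hind hP n (badN j)).trans (hbadN j)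
        _ = _ := by simp
  have hzero : ∀ y : ℝ, Tendsto (fun n : ℕ => ENNReal.ofReal (y / n)) atTop (𝓝 0) := fun y => by
    simpa using ENNReal.tendsto_ofReal (tendsto_const_div_atTop_nhds_zero_nat y)
  refine tendsto_of_tendsto_of_tendsto_of_le_of_le' tendsto_const_nhds ?_
    (.of_forall fun n => zero_le) hbound
  have h1 := ENNReal.Tendsto.const_mul (a := 4) (hzero A) (.inr (by simp))
  have h2 := ENNReal.Tendsto.const_mul (a := (dY : ℝ≥0∞)) h1 (.inr (by simp))
  simpa using hchat.add ((hzero R).add h2)
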